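/- Let $C$ be a unital Abelian C$^*$-algebra, and let $X$ and $Y$ be central representable Banach $C$-bimodules: $cx=xc$ for all $c\in C$, $x\in X$, and there are Hilbert spaces $\mathcal H,\mathcal K$ with $*$-representations $\pi:C\to B(\mathcal H)$, $\sigma:C\to B(\mathcal K)$ and a linear isometry $\Phi:X\to B(\mathcal K,\mathcal H)$ such that $\Phi(cx)=\pi(c)\Phi(x)$ and $\Phi(xc)=\Phi(x)\sigma(c)$; similarly for $Y$. Let $X\stackrel{\gamma}{\otimes}_CY$ be the projective tensor product of Banach $C$-modules, that is, the quotient of the Banach space projective tensor product $X\stackrel{\gamma}{\otimes}Y$ by the closed subspace generated by all $xc\otimes y-x\otimes cy$ ($x\in X$, $y\in Y$, $c\in C$), and let $\gamma_C(w)$ be the norm in it of the image of an element $w$ of the algebraic tensor product $X\otimes_CY$. For $A\in\{\mathbb C,C\}$ and $w\in X\otimes_CY$ put $$\gamma_{A}^{\mathrm{bim}}(w)=\inf\Big\{\Big\|\sum_{j=1}^n a_ja_j^*\Big\|^{1/2}\Big\|\sum_{j=1}^n b_j^*b_j\Big\|^{1/2}:\ w=\sum_{j=1}^n a_jx_j\otimes_Cy_jb_j,\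 a_j,b_j\in A,\ \|x_j\|\le1,\ \|y_j\|\le1\Big\},$$ and let ${}_AX\stackrel{\gamma}{\otimes}_CY_A$ be the completion of the quotient of $X\otimes_CY$ by the zero space of the seminorm $\gamma_A^{\mathrm{bim}}$. Then: 1. For each $w\in X\otimes_CY$, $$\gamma_C(w)=\inf\Big\{\Big\|\sum_{j=1}^n c_j\Big\|:\ w=\sum_{j=1}^n c_jx_j\otimes_Cy_j,\ c_j\in C^+,\ x_j\in X,\ y_j\in Y,\ \|x_j\|\le1,\ \|y_j\|\le1\Big\}.$$ 2. Consequently $\gamma_{\mathbb C}^{\mathrm{bim}}=\gamma_{C}^{\mathrm{bim}}=\gamma_C$ on $X\otimes_CY$, and $${}_{\mathbb C}X\stackrel{\gamma}{\otimes}_CY_{\mathbb C}={}_{C}X\stackrel{\gamma}{\otimes}_CY_{C}=X\stackrel{\gamma}{\otimes}_CY,$$ in the sense that these three Banach spaces are isometrically isomorphic by $C$-module isomorphisms that are compatible with the canonical maps from $X\otimes_CY$. -/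

import Mathlib

open scoped TensorProduct
open UniformSpace (Completion)

noncomputable section

set_option linter.unusedSectionVars false

universe w u₁ u₂ u₃ u₄ u₅

/-! ### Representable bimodules -/

/-- A normed `A`-`B`-bimodule `X` over unital C*-algebras (`a • x` is the left action and
`MulOpposite.op b • x`, that is `x b`, the right action) is representable if there are Hilbert
spaces `H`, `K` with unital `*`-representations `π` of `A` on `H` and `σ` of `B` on `K`, and an
isometric bimodule homomorphism of `X` into the bounded operators from `K` to `H`. -/
def IsRepresentable (A : Type u₁) (B : Type u₂) (X : Type u₃) [CStarAlgebra A] [CStarAlgebra B]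
    [NormedAddCommGroup X] [NormedSpace ℂ X] [Module A X] [Module Bᵐᵒᵖ X] : Prop :=
  ∃ (H K : Type w) (_ : NormedAddCommGroup H) (_ : InnerProductSpace ℂ H) (_ : CompleteSpace H)
    (_ : NormedAddCommGroup K) (_ : InnerProductSpace ℂ K) (_ : CompleteSpace K)
    (π : A →⋆ₐ[ℂ] (H →L[ℂ] H)) (σ : B →⋆ₐ[ℂ] (K →L[ℂ] K)) (Φ : X →ₗᵢ[ℂ] (K →L[ℂ] H)),
    (∀ (a : A) (x : X), Φ (a • x) = (π a).comp (Φ x)) ∧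
    (∀ (b : B) (x : X), Φ (MulOpposite.op b • x) = (Φ x).comp (σ b))

/-! ### The bimodule projective tensor product `_A X ⊗^γ_R Y_D` (with `R` commutative) -/

section Gamma

variable (A : Type u₁) {R : Type u₂} (D : Type u₃) {X : Type u₄} {Y : Type u₅}
  [CStarAlgebra A] [CommCStarAlgebra R] [CStarAlgebra D]
  [NormedAddCommGroup X] [NormedSpace ℂ X] [NormedAddCommGroup Y] [NormedSpace ℂ Y]
  [Module R X] [Module R Y] [Module A X] [Module Dᵐᵒᵖ Y]

/-- `GammaRep A D w a b x y`: the element `w` is written as `∑ j, a_j x_j ⊗ y_j b_j` with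
`x_j`, `y_j` in the closed unit balls. -/
structure GammaRep (w : X ⊗[R] Y) {n : ℕ} (a : Fin n → A) (b : Fin n → D)
    (x : Fin n → X) (y : Fin n → Y) : Prop where
  norm_left : ∀ j, ‖x j‖ ≤ 1
  norm_right : ∀ j, ‖y j‖ ≤ 1
  eq_sum : w = ∑ j, (a j • x j) ⊗ₜ[R] (MulOpposite.op (b j) • y j)

/-- The projective tensor seminorm `γ` of `_A X ⊗_R Y_D`: the infimum of
`‖∑ a_j a_j*‖^(1/2) ‖∑ b_j* b_j‖^(1/2)` over all representations
`w = ∑ a_j x_j ⊗ y_j b_j` with `‖x_j‖ ≤ 1` and `‖y_j‖ ≤ 1`. -/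
def gammaNorm (w : X ⊗[R] Y) : ℝ :=
  sInf {r : ℝ | ∃ (n : ℕ) (a : Fin n → A) (b : Fin n → D) (x : Fin n → X) (y : Fin n → Y),
    GammaRep A D w a b x y ∧
      r = √‖∑ j, a j * star (a j)‖ * √‖∑ j, star (b j) * b j‖}

/-- The algebraic tensor product `X ⊗_R Y`, to be equipped with the seminorm `gammaNorm A D`. -/
@[nolint unusedArguments]
def GammaTensor (_A : Type u₁) (R : Type u₂) (_D : Type u₃) (X : Type u₄) (Y : Type u₅)
    [CommCStarAlgebra R] [NormedAddCommGroup X] [NormedAddCommGroup Y] [Module R X] [Module R Y] :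
    Type (max u₄ u₅) := X ⊗[R] Y

variable (R X Y)

instance : AddCommGroup (GammaTensor A R D X Y) := inferInstanceAs (AddCommGroup (X ⊗[R] Y))

instance {S : Type*} [Semiring S] [Module S X] [SMulCommClass R S X] :
    Module S (GammaTensor A R D X Y) := inferInstanceAs (Module S (X ⊗[R] Y))

variable {R X Y}
variable [IsScalarTower ℂ R X] [IsScalarTower ℂ R Y] [IsScalarTower ℂ A X]
  [IsScalarTower ℂ Dᵐᵒᵖ Y]

theorem GammaRep.rescale {w : X ⊗[R] Y} {n : ℕ} {a : Fin n → A} {b : Fin n → D}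
    {x : Fin n → X} {y : Fin n → Y} (h : GammaRep A D w a b x y) {l m : ℂ} (hlm : l * m = 1) :
    GammaRep A D w (fun j => l • a j) (fun j => m • b j) x y := by
  refine ⟨h.1, h.2, h.3.trans (Finset.sum_congr rfl fun j _ => ?_)⟩
  rw [MulOpposite.op_smul, smul_assoc, smul_assoc, TensorProduct.smul_tmul (R' := ℂ) l,
    smul_smul, hlm, one_smul]

theorem GammaRep.append {w₁ w₂ : X ⊗[R] Y} {n m : ℕ} {a₁ : Fin n → A} {b₁ : Fin n → D}
    {x₁ : Fin n → X} {y₁ : Fin n → Y} {a₂ : Fin m → A} {b₂ : Fin m → D}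
    {x₂ : Fin m → X} {y₂ : Fin m → Y} (h₁ : GammaRep A D w₁ a₁ b₁ x₁ y₁)
    (h₂ : GammaRep A D w₂ a₂ b₂ x₂ y₂) :
    GammaRep A D (w₁ + w₂) (Fin.append a₁ a₂) (Fin.append b₁ b₂) (Fin.append x₁ x₂)
      (Fin.append y₁ y₂) := by
  refine ⟨fun j => ?_, fun j => ?_, ?_⟩
  · refine Fin.addCases (fun i => ?_) (fun i => ?_) j
    · simpa using h₁.1 i
    · simpa using h₂.1 i
  · refine Fin.addCases (fun i => ?_) (fun i => ?_) j
    · simpa using h₁.2 i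
    · simpa using h₂.2 i
  · rw [Fin.sum_univ_add, h₁.3, h₂.3]
    simp

theorem norm_inv_smul_le_one {Z : Type*} [NormedAddCommGroup Z] [NormedSpace ℂ Z] (z : Z) :
    ‖((‖z‖ : ℂ) + 1)⁻¹ • z‖ ≤ 1 := by
  have : ‖((‖z‖ : ℂ) + 1)‖ = ‖z‖ + 1 := by
    have h : ((‖z‖ : ℂ) + 1) = ((‖z‖ + 1 : ℝ) : ℂ) := by push_cast; rfl
    rw [h, Complex.norm_real, Real.norm_of_nonneg (by positivity)]
  rw [norm_smul, norm_inv, this, inv_mul_le_iff₀ (by positivity)]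
  linarith

theorem exists_gammaRep (w : X ⊗[R] Y) :
    ∃ (n : ℕ) (a : Fin n → A) (b : Fin n → D) (x : Fin n → X) (y : Fin n → Y),
      GammaRep A D w a b x y := by
  induction w using TensorProduct.induction_on with
  | zero => exact ⟨0, Fin.elim0, Fin.elim0, Fin.elim0, Fin.elim0, fun j => j.elim0,
      fun j => j.elim0, by simp⟩
  | tmul x y =>
    have hx : ((‖x‖ : ℂ) + 1) ≠ 0 := by
      have : (0 : ℝ) < ‖x‖ + 1 := by positivity
      exact_mod_cast this.ne'
    have hy : ((‖y‖ : ℂ) + 1) ≠ 0 := by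
      have : (0 : ℝ) < ‖y‖ + 1 := by positivity
      exact_mod_cast this.ne'
    refine ⟨1, fun _ => ((‖x‖ : ℂ) + 1) • 1, fun _ => ((‖y‖ : ℂ) + 1) • 1,
      fun _ => ((‖x‖ : ℂ) + 1)⁻¹ • x, fun _ => ((‖y‖ : ℂ) + 1)⁻¹ • y,
      fun _ => norm_inv_smul_le_one x, fun _ => norm_inv_smul_le_one y, ?_⟩
    simp [MulOpposite.op_smul, smul_assoc, smul_smul, hx, hy]
  | add w₁ w₂ h₁ h₂ =>
    obtain ⟨n, a, b, x, y, h⟩ := h₁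
    obtain ⟨m, a', b', x', y', h'⟩ := h₂
    exact ⟨n + m, _, _, _, _, h.append A D h'⟩

theorem gammaNorm_nonneg (w : X ⊗[R] Y) : 0 ≤ gammaNorm A D w := by
  refine Real.sInf_nonneg ?_
  rintro r ⟨n, a, b, x, y, -, rfl⟩
  positivity

theorem GammaRep.gammaNorm_le {w : X ⊗[R] Y} {n : ℕ} {a : Fin n → A} {b : Fin n → D}
    {x : Fin n → X} {y : Fin n → Y} (h : GammaRep A D w a b x y) {t : ℝ}
    (ha : ‖∑ j, a j * star (a j)‖ ≤ t) (hb : ‖∑ j, star (b j) * b j‖ ≤ t) :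
    gammaNorm A D w ≤ t := by
  have ht : 0 ≤ t := (norm_nonneg _).trans ha
  have hle : gammaNorm A D w ≤ √‖∑ j, a j * star (a j)‖ * √‖∑ j, star (b j) * b j‖ := by
    refine csInf_le ⟨0, ?_⟩ ⟨n, a, b, x, y, h, rfl⟩
    rintro r ⟨n, a, b, x, y, -, rfl⟩
    positivity
  refine hle.trans ?_
  · calc _ ≤ √t * √t := by gcongr
      _ = t := Real.mul_self_sqrt ht

theorem norm_sum_smul_mul_star {n : ℕ} (a : Fin n → A) (l : ℝ) :
    ‖∑ j, ((l : ℂ) • a j) * star ((l : ℂ) • a j)‖ = l ^ 2 * ‖∑ j, a j * star (a j)‖ := by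
  have : ∑ j, ((l : ℂ) • a j) * star ((l : ℂ) • a j)
      = ((l ^ 2 : ℝ) : ℂ) • ∑ j, a j * star (a j) := by
    rw [Finset.smul_sum]
    refine Finset.sum_congr rfl fun j _ => ?_
    rw [star_smul, smul_mul_smul_comm]
    congr 1
    simp [sq]
  rw [this, norm_smul, Complex.norm_real, Real.norm_of_nonneg (sq_nonneg l)]

theorem norm_sum_star_mul_smul {n : ℕ} (a : Fin n → A) (l : ℝ) :
    ‖∑ j, star ((l : ℂ) • a j) * ((l : ℂ) • a j)‖ = l ^ 2 * ‖∑ j, star (a j) * a j‖ := by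
  simpa using norm_sum_smul_mul_star A (fun j => star (a j)) l

theorem exists_gammaRep_of_lt {w : X ⊗[R] Y} {t : ℝ} (ht : gammaNorm A D w < t) :
    ∃ (n : ℕ) (a : Fin n → A) (b : Fin n → D) (x : Fin n → X) (y : Fin n → Y),
      GammaRep A D w a b x y ∧ ‖∑ j, a j * star (a j)‖ ≤ t ∧ ‖∑ j, star (b j) * b j‖ ≤ t := by
  have ht0 : 0 < t := (gammaNorm_nonneg A D w).trans_lt ht
  obtain ⟨n₀, a₀, b₀, x₀, y₀, h₀⟩ := exists_gammaRep A D w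
  obtain ⟨r, ⟨n, a, b, x, y, h, rfl⟩, hr⟩ :=
    exists_lt_of_csInf_lt (by exact ⟨_, n₀, a₀, b₀, x₀, y₀, h₀, rfl⟩) ht
  obtain ⟨p, hp⟩ : ∃ p, p = ‖∑ j, a j * star (a j)‖ := ⟨_, rfl⟩
  obtain ⟨q, hq⟩ : ∃ q, q = ‖∑ j, star (b j) * b j‖ := ⟨_, rfl⟩
  have hp0 : 0 ≤ p := hp ▸ norm_nonneg _
  have hq0 : 0 ≤ q := hq ▸ norm_nonneg _
  rw [← hp, ← hq, ← Real.sqrt_mul hp0, Real.sqrt_lt' ht0] at hr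
  obtain ⟨s, hs, hs1, hs2⟩ : ∃ s : ℝ, 0 < s ∧ s * p ≤ t ∧ s⁻¹ * q ≤ t := by
    rcases hp0.eq_or_lt with h0 | h0
    · refine ⟨q / t + 1, by positivity, by rw [← h0]; simpa using ht0.le, ?_⟩
      rw [inv_mul_le_iff₀ (by positivity), add_mul, div_mul_cancel₀ _ ht0.ne']
      linarith
    · refine ⟨t / p, by positivity, by rw [div_mul_cancel₀ _ h0.ne'], ?_⟩
      rw [inv_mul_le_iff₀ (by positivity), div_mul_eq_mul_div, le_div_iff₀ h0]
      nlinarith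
  have hl : ((√s : ℝ) : ℂ) * ((√s⁻¹ : ℝ) : ℂ) = 1 := by
    rw [← Complex.ofReal_mul, ← Real.sqrt_mul hs.le, mul_inv_cancel₀ hs.ne']
    simp
  refine ⟨n, _, _, x, y, h.rescale A D hl, ?_, ?_⟩
  · rw [norm_sum_smul_mul_star, Real.sq_sqrt hs.le, ← hp]
    exact hs1
  · rw [norm_sum_star_mul_smul, Real.sq_sqrt (inv_nonneg.2 hs.le), ← hq]
    exact hs2

theorem gammaNorm_zero : gammaNorm A D (0 : X ⊗[R] Y) = 0 := by
  refine le_antisymm ?_ (gammaNorm_nonneg A D _)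
  have h : GammaRep A D (0 : X ⊗[R] Y) (n := 0) Fin.elim0 Fin.elim0 Fin.elim0 Fin.elim0 :=
    ⟨fun j => j.elim0, fun j => j.elim0, by simp⟩
  exact h.gammaNorm_le A D (by simp) (by simp)

theorem gammaNorm_add_le (w₁ w₂ : X ⊗[R] Y) :
    gammaNorm A D (w₁ + w₂) ≤ gammaNorm A D w₁ + gammaNorm A D w₂ := by
  refine le_of_forall_pos_le_add fun ε hε => ?_
  obtain ⟨n, a, b, x, y, h, ha, hb⟩ :=
    exists_gammaRep_of_lt A D (show gammaNorm A D w₁ < gammaNorm A D w₁ + ε / 2 by linarith)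
  obtain ⟨m, a', b', x', y', h', ha', hb'⟩ :=
    exists_gammaRep_of_lt A D (show gammaNorm A D w₂ < gammaNorm A D w₂ + ε / 2 by linarith)
  refine (h.append A D h').gammaNorm_le A D ?_ ?_
  · rw [Fin.sum_univ_add]
    simp only [Fin.append_left, Fin.append_right]
    linarith [norm_add_le (∑ j, a j * star (a j)) (∑ j, a' j * star (a' j))]
  · rw [Fin.sum_univ_add]
    simp only [Fin.append_left, Fin.append_right]
    linarith [norm_add_le (∑ j, star (b j) * b j) (∑ j, star (b' j) * b' j)]

/-- Scalars `S` that act contractively on `X`, compatibly with the other actions, act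
contractively on the tensor product (by `s (x ⊗ y) = s x ⊗ y`). -/
theorem gammaNorm_smul_le {S : Type*} [SeminormedRing S] [Module S X] [IsBoundedSMul S X]
    [SMulCommClass R S X] [SMulCommClass S A X] (s : S) (w : X ⊗[R] Y) :
    gammaNorm A D (s • w) ≤ ‖s‖ * gammaNorm A D w := by
  refine le_mul_of_forall_lt₀ fun p hp t ht => ?_
  have hp0 : 0 < p := (norm_nonneg s).trans_lt hp
  obtain ⟨n, a, b, x, y, h, ha, hb⟩ := exists_gammaRep_of_lt A D ht
  have hpp : ((√p : ℝ) : ℂ) * ((√p : ℝ) : ℂ) = (p : ℂ) := by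
    rw [← Complex.ofReal_mul, Real.mul_self_sqrt hp0.le]
  have hpc : (p : ℂ) ≠ 0 := by exact_mod_cast hp0.ne'
  have key : GammaRep A D (s • w) (fun j => ((√p : ℝ) : ℂ) • a j)
      (fun j => ((√p : ℝ) : ℂ) • b j) (fun j => (p : ℂ)⁻¹ • s • x j) y := by
    refine ⟨fun j => ?_, h.2, ?_⟩
    · rw [norm_smul, norm_inv, Complex.norm_real, Real.norm_of_nonneg hp0.le,
        inv_mul_le_iff₀ hp0, mul_one]
      calc ‖s • x j‖ ≤ ‖s‖ * ‖x j‖ := norm_smul_le _ _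
        _ ≤ ‖s‖ * 1 := by gcongr; exact h.1 j
        _ ≤ p := by linarith
    · rw [h.3, Finset.smul_sum]
      refine Finset.sum_congr rfl fun j _ => ?_
      rw [MulOpposite.op_smul, smul_assoc, smul_assoc,
        ← TensorProduct.smul_tmul (R' := ℂ) ((√p : ℝ) : ℂ), smul_comm (a j) ((p : ℂ)⁻¹), smul_smul, smul_smul, hpp, mul_inv_cancel₀ hpc, one_smul,
        TensorProduct.smul_tmul', smul_comm]
  refine key.gammaNorm_le A D ?_ ?_
  · rw [norm_sum_smul_mul_star, Real.sq_sqrt hp0.le]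
    gcongr
  · rw [norm_sum_star_mul_smul, Real.sq_sqrt hp0.le]
    gcongr

variable (R X Y)

/-- `gammaNorm` as a seminorm. -/
def gammaSeminorm : Seminorm ℂ (GammaTensor A R D X Y) :=
  Seminorm.ofSMulLE (E := GammaTensor A R D X Y) (gammaNorm A D (R := R) (X := X) (Y := Y))
    (gammaNorm_zero A D) (gammaNorm_add_le A D) (gammaNorm_smul_le A D)

instance : SeminormedAddCommGroup (GammaTensor A R D X Y) :=
  (gammaSeminorm A R D X Y).toAddGroupSeminorm.toSeminormedAddCommGroup

instance {S : Type*} [SeminormedRing S] [Module S X] [IsBoundedSMul S X]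
    [SMulCommClass R S X] [SMulCommClass S A X] : IsBoundedSMul S (GammaTensor A R D X Y) :=
  IsBoundedSMul.of_norm_smul_le (gammaNorm_smul_le A D (R := R) (X := X) (Y := Y))

instance : NormedSpace ℂ (GammaTensor A R D X Y) where
  norm_smul_le := gammaNorm_smul_le A D (R := R) (X := X) (Y := Y)

/-- The tensor product `_A X ⊗^γ_R Y_D`: the (Hausdorff) completion of `X ⊗_R Y` with respect to
the seminorm `gammaNorm A D`. -/
abbrev GammaProduct : Type (max u₄ u₅) := Completion (GammaTensor A R D X Y)

variable {R X Y}

/-- The canonical map `X ⊗_R Y → _A X ⊗^γ_R Y_D`. -/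
def toGammaProduct (w : X ⊗[R] Y) : GammaProduct A R D X Y :=
  ((show GammaTensor A R D X Y from w) : Completion (GammaTensor A R D X Y))

theorem norm_toGammaProduct (w : X ⊗[R] Y) : ‖toGammaProduct A D w‖ = gammaNorm A D w :=
  Completion.norm_coe (E := GammaTensor A R D X Y) _

end Gamma

/-! ### The Banach space projective tensor product -/

section Proj

variable (X : Type u₄) (Y : Type u₅)
  [NormedAddCommGroup X] [NormedSpace ℂ X] [NormedAddCommGroup Y] [NormedSpace ℂ Y]

variable {X Y} in
/-- The projective tensor norm on `X ⊗ Y`: the infimum of `∑ ‖x_j‖ ‖y_j‖` over all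
representations `w = ∑ x_j ⊗ y_j`. -/
def projNorm (w : X ⊗[ℂ] Y) : ℝ :=
  sInf {r : ℝ | ∃ (n : ℕ) (x : Fin n → X) (y : Fin n → Y),
    w = ∑ j, x j ⊗ₜ[ℂ] y j ∧ r = ∑ j, ‖x j‖ * ‖y j‖}

/-- The algebraic tensor product `X ⊗ Y` of normed spaces, to be equipped with `projNorm`. -/
def ProjTensor : Type (max u₄ u₅) := X ⊗[ℂ] Y

instance : AddCommGroup (ProjTensor X Y) := inferInstanceAs (AddCommGroup (X ⊗[ℂ] Y))

instance {S : Type*} [Semiring S] [Module S X] [SMulCommClass ℂ S X] :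
    Module S (ProjTensor X Y) := inferInstanceAs (Module S (X ⊗[ℂ] Y))

instance {S T : Type*} [Semiring S] [Module S X] [SMulCommClass ℂ S X] [Semiring T] [Module T X]
    [SMulCommClass ℂ T X] [SMul S T] [IsScalarTower S T X] :
    IsScalarTower S T (ProjTensor X Y) := inferInstanceAs (IsScalarTower S T (X ⊗[ℂ] Y))

variable {X Y}

theorem projNorm_le {w : X ⊗[ℂ] Y} {n : ℕ} {x : Fin n → X} {y : Fin n → Y}
    (h : w = ∑ j, x j ⊗ₜ[ℂ] y j) : projNorm w ≤ ∑ j, ‖x j‖ * ‖y j‖ := by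
  refine csInf_le ⟨0, ?_⟩ ⟨n, x, y, h, rfl⟩
  rintro r ⟨n, x, y, -, rfl⟩
  positivity

theorem projNorm_nonneg (w : X ⊗[ℂ] Y) : 0 ≤ projNorm w := by
  refine Real.sInf_nonneg ?_
  rintro r ⟨n, x, y, -, rfl⟩
  positivity

theorem exists_rep_of_projNorm_lt {w : X ⊗[ℂ] Y} {t : ℝ} (ht : projNorm w < t) :
    ∃ (n : ℕ) (x : Fin n → X) (y : Fin n → Y),
      w = ∑ j, x j ⊗ₜ[ℂ] y j ∧ ∑ j, ‖x j‖ * ‖y j‖ < t := by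
  have hne : ∃ (n : ℕ) (x : Fin n → X) (y : Fin n → Y), w = ∑ j, x j ⊗ₜ[ℂ] y j := by
    clear ht
    induction w using TensorProduct.induction_on with
    | zero => exact ⟨0, Fin.elim0, Fin.elim0, by simp⟩
    | tmul x y => exact ⟨1, fun _ => x, fun _ => y, by simp⟩
    | add w₁ w₂ h₁ h₂ =>
      obtain ⟨n, x, y, h⟩ := h₁
      obtain ⟨m, x', y', h'⟩ := h₂
      exact ⟨n + m, Fin.append x x', Fin.append y y', by rw [Fin.sum_univ_add, h, h']; simp⟩
  obtain ⟨n₀, x₀, y₀, h₀⟩ := hne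
  obtain ⟨r, ⟨n, x, y, h, rfl⟩, hr⟩ := 
    exists_lt_of_csInf_lt (by exact ⟨_, n₀, x₀, y₀, h₀, rfl⟩) ht
  exact ⟨n, x, y, h, hr⟩

theorem projNorm_zero : projNorm (0 : X ⊗[ℂ] Y) = 0 :=
  le_antisymm ((projNorm_le (n := 0) (x := Fin.elim0) (y := Fin.elim0) (by simp)).trans (by simp))
    (projNorm_nonneg _)

theorem projNorm_add_le (w₁ w₂ : X ⊗[ℂ] Y) :
    projNorm (w₁ + w₂) ≤ projNorm w₁ + projNorm w₂ := by
  refine le_of_forall_pos_le_add fun ε hε => ?_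
  obtain ⟨n, x, y, h, hr⟩ :=
    exists_rep_of_projNorm_lt (show projNorm w₁ < projNorm w₁ + ε / 2 by linarith)
  obtain ⟨m, x', y', h', hr'⟩ :=
    exists_rep_of_projNorm_lt (show projNorm w₂ < projNorm w₂ + ε / 2 by linarith)
  refine (projNorm_le (x := Fin.append x x') (y := Fin.append y y') ?_).trans ?_
  · rw [Fin.sum_univ_add, h, h']
    simp
  · rw [Fin.sum_univ_add]
    simp only [Fin.append_left, Fin.append_right]
    linarith

theorem projNorm_smul_le {S : Type*} [SeminormedRing S] [Module S X] [IsBoundedSMul S X]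
    [SMulCommClass ℂ S X] (s : S) (w : X ⊗[ℂ] Y) : projNorm (s • w) ≤ ‖s‖ * projNorm w := by
  refine le_mul_of_forall_lt₀ fun p hp t ht => ?_
  have hp0 : 0 < p := (norm_nonneg s).trans_lt hp
  obtain ⟨n, x, y, h, hr⟩ := exists_rep_of_projNorm_lt ht
  refine (projNorm_le (x := fun j => s • x j) (y := y) ?_).trans ?_
  · rw [h, Finset.smul_sum]
    rfl
  · calc ∑ j, ‖s • x j‖ * ‖y j‖ ≤ ∑ j, p * (‖x j‖ * ‖y j‖) := by
          refine Finset.sum_le_sum fun j _ => ?_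
          rw [← mul_assoc]
          gcongr
          exact (norm_smul_le _ _).trans (by gcongr)
      _ = p * ∑ j, ‖x j‖ * ‖y j‖ := by rw [Finset.mul_sum]
      _ ≤ p * t := by gcongr

variable (X Y)

/-- `projNorm` as a seminorm. -/
def projSeminorm : Seminorm ℂ (ProjTensor X Y) :=
  Seminorm.ofSMulLE (E := ProjTensor X Y) (projNorm (X := X) (Y := Y)) projNorm_zero
    projNorm_add_le projNorm_smul_le

instance : SeminormedAddCommGroup (ProjTensor X Y) :=
  (projSeminorm X Y).toAddGroupSeminorm.toSeminormedAddCommGroup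

instance {S : Type*} [SeminormedRing S] [Module S X] [IsBoundedSMul S X]
    [SMulCommClass ℂ S X] : IsBoundedSMul S (ProjTensor X Y) :=
  IsBoundedSMul.of_norm_smul_le (projNorm_smul_le (X := X) (Y := Y))

instance : NormedSpace ℂ (ProjTensor X Y) where
  norm_smul_le := projNorm_smul_le (X := X) (Y := Y)

/-- The Banach space projective tensor product `X ⊗^γ Y`. -/
abbrev ProjProduct : Type (max u₄ u₅) := Completion (ProjTensor X Y)

variable {X Y}

/-- The canonical map `X ⊗ Y → X ⊗^γ Y`. -/
def toProjProduct (w : X ⊗[ℂ] Y) : ProjProduct X Y :=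
  ((show ProjTensor X Y from w) : Completion (ProjTensor X Y))

theorem toProjProduct_add (w₁ w₂ : X ⊗[ℂ] Y) :
    toProjProduct (w₁ + w₂) = toProjProduct w₁ + toProjProduct w₂ :=
  Completion.coe_add (α := ProjTensor X Y) _ _

theorem toProjProduct_sub (w₁ w₂ : X ⊗[ℂ] Y) :
    toProjProduct (w₁ - w₂) = toProjProduct w₁ - toProjProduct w₂ :=
  Completion.coe_sub (α := ProjTensor X Y) _ _

theorem toProjProduct_smul {S : Type*} [SeminormedRing S] [Module S X] [IsBoundedSMul S X]
    [SMulCommClass ℂ S X] (s : S) (w : X ⊗[ℂ] Y) :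
    toProjProduct (s • w) = s • toProjProduct w :=
  Completion.coe_smul s (show ProjTensor X Y from w)

end Proj

/-! ### The projective tensor product of Banach `C`-modules -/

section Balanced

variable (C : Type u₁) (X : Type u₄) (Y : Type u₅) [CommCStarAlgebra C]
  [NormedAddCommGroup X] [NormedSpace ℂ X] [Module C X] [Module Cᵐᵒᵖ X] [IsScalarTower ℂ C X]
  [IsBoundedSMul C X] [NormedAddCommGroup Y] [NormedSpace ℂ Y] [Module C Y] [IsScalarTower ℂ C Y]

/-- The elements `x c ⊗ y - x ⊗ c y` of `X ⊗^γ Y`. -/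
def balancedRelations : Set (ProjProduct X Y) :=
  {z | ∃ (x : X) (c : C) (y : Y),
    z = toProjProduct ((MulOpposite.op c • x) ⊗ₜ[ℂ] y - x ⊗ₜ[ℂ] (c • y))}

/-- The closed subspace of `X ⊗^γ Y` generated by all `x c ⊗ y - x ⊗ c y`, as a `C`-submodule
(see `coe_balancedSubmodule`). -/
def balancedSubmodule : Submodule C (ProjProduct X Y) :=
  (Submodule.span C (balancedRelations C X Y)).topologicalClosure

instance : IsClosed (balancedSubmodule C X Y : Set (ProjProduct X Y)) :=
  Submodule.isClosed_topologicalClosure _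

/-- The quotient of the Banach space projective tensor product `X ⊗^γ Y` by the closed subspace
generated by all `x c ⊗ y - x ⊗ c y`, with the quotient norm. -/
abbrev BanachModuleTensor : Type (max u₄ u₅) := ProjProduct X Y ⧸ balancedSubmodule C X Y

variable [IsCentralScalar C X]

/-- The `C`-submodule `balancedSubmodule` is the closed complex linear span of the
elements `x c ⊗ y - x ⊗ c y`. -/
theorem coe_balancedSubmodule :
    (balancedSubmodule C X Y : Set (ProjProduct X Y)) =
      closure (Submodule.span ℂ (balancedRelations C X Y) : Set (ProjProduct X Y)) := by
  have : (Submodule.span C (balancedRelations C X Y) : Set (ProjProduct X Y)) =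
      (Submodule.span ℂ (balancedRelations C X Y) : Set (ProjProduct X Y)) := by
    refine Set.Subset.antisymm ?_ (Submodule.span_subset_span ℂ C _)
    intro z hz
    induction hz using Submodule.span_induction with
    | mem z hz => exact Submodule.subset_span hz
    | zero => exact zero_mem _
    | add z z' _ _ h h' => exact add_mem h h'
    | smul c z hz h =>
      clear hz
      induction h using Submodule.span_induction with
      | mem z hz =>
        obtain ⟨x, d, y, rfl⟩ := hz
        refine Submodule.subset_span ⟨c • x, d, y, ?_⟩
        rw [← toProjProduct_smul, smul_sub, TensorProduct.smul_tmul', TensorProduct.smul_tmul',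
          op_smul_eq_smul, op_smul_eq_smul, smul_comm]
      | zero => simp
      | add z z' _ _ h h' => rw [smul_add]; exact add_mem h h'
      | smul l z _ h => rw [smul_comm]; exact Submodule.smul_mem _ _ h
  rw [← this]
  rfl

variable {C X Y}

/-- The canonical map `X ⊗_C Y → X ⊗^γ_C Y`, `x ⊗ y ↦ x ⊗ y`. -/
def toBanachModuleTensor : X ⊗[C] Y →+ BanachModuleTensor C X Y :=
  TensorProduct.liftAddHom
    (AddMonoidHom.mk'
      (fun x => AddMonoidHom.mk'
        (fun y => (balancedSubmodule C X Y).mkQ (toProjProduct (x ⊗ₜ[ℂ] y)))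
        (fun y y' => by rw [TensorProduct.tmul_add, toProjProduct_add, map_add]))
      (fun x x' => by
        ext y
        simp only [AddMonoidHom.mk'_apply, AddMonoidHom.add_apply]
        rw [TensorProduct.add_tmul, toProjProduct_add, map_add]))
    (fun c x y => by
      simp only [AddMonoidHom.mk'_apply]
      rw [← sub_eq_zero, ← map_sub, ← toProjProduct_sub, Submodule.mkQ_apply,
        Submodule.Quotient.mk_eq_zero]
      refine Submodule.le_topologicalClosure _ (Submodule.subset_span ⟨x, c, y, ?_⟩)
      rw [op_smul_eq_smul])

theorem toBanachModuleTensor_tmul (x : X) (y : Y) :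
    toBanachModuleTensor (x ⊗ₜ[C] y) =
      (balancedSubmodule C X Y).mkQ (toProjProduct (x ⊗ₜ[ℂ] y)) := rfl

end Balanced

end

/-! Everything follows from the cycle `‖toBanachModuleTensor w‖ ≤ gammaNorm C C w ≤ gammaNorm ℂ ℂ w
≤ ‖toBanachModuleTensor w‖`. The last inequality holds because `‖toBanachModuleTensor w‖` is the
infimum of `∑ ‖x_j‖ ‖y_j‖` over representations of `w` in `X ⊗[C] Y`: such weights can be split into
square roots, one for each side. The middle one holds because scalars embed in `C`. Positive
coefficients `c_j` likewise split as `√c_j √c_j`, so the infimum in the first assertion lies between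
`gammaNorm C C w` and `‖toBanachModuleTensor w‖`.

The substance is the first inequality, which rests on `C`-convexity of the unit ball of `X ⊗^γ_C Y`:
if `0 ≤ f ≤ 1` in `C` and `u`, `v` lie in the ball, so does `f u + (1 - f) v`. Representability
gives this when `f` and `1 - f` are replaced by `a²` and `b²` with `ab = 0`: then `‖a x + b x'‖ ≤
max ‖a x‖ ‖b x'‖`, and the cross terms of `(a x + b x') ⊗ (a y + b y')` vanish. A general `f` is cut
into `N` layers so that `f` and `1 - f` become averages of such orthogonal squares up to an error
`1/N` (`exists_orthogonal_layers`).

By induction, `∑ c_j u_j = (∑ c_j) v` with `v` in the ball (`exists_sum_smul_eq_sum_smul`). Finally,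
coefficients `a_j`, `b_j` reduce to a single positive one by the inequality `|ab| ≤ (|a|² + |b|²) /
2`. -/

noncomputable section

set_option linter.unusedSectionVars false

/-! ### The quotient norm on `X ⊗_C Y` computed from finite representations. -/

section BanachModuleTensorNorm

variable {C X Y : Type*} [CommCStarAlgebra C]
  [NormedAddCommGroup X] [NormedSpace ℂ X]
  [Module C X] [Module Cᵐᵒᵖ X] [IsCentralScalar C X] [IsScalarTower ℂ C X] [IsBoundedSMul C X]
  [NormedAddCommGroup Y] [NormedSpace ℂ Y] [Module C Y] [IsScalarTower ℂ C Y]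

theorem norm_toProjProduct (w : X ⊗[ℂ] Y) : ‖toProjProduct w‖ = projNorm w :=
  Completion.norm_coe (E := ProjTensor X Y) _

theorem toBanachModuleTensor_smul (c : C) (w : X ⊗[C] Y) :
    toBanachModuleTensor (c • w) = c • toBanachModuleTensor w := by
  induction w using TensorProduct.induction_on with
  | zero => simp
  | tmul x y =>
    rw [TensorProduct.smul_tmul', toBanachModuleTensor_tmul, toBanachModuleTensor_tmul,
      ← map_smul, ← toProjProduct_smul, TensorProduct.smul_tmul']
  | add w₁ w₂ h₁ h₂ => rw [smul_add, map_add, map_add, smul_add, h₁, h₂]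

theorem norm_toBanachModuleTensor_smul_le (c : C) (w : X ⊗[C] Y) :
    ‖toBanachModuleTensor (c • w)‖ ≤ ‖c‖ * ‖toBanachModuleTensor w‖ := by
  rw [toBanachModuleTensor_smul]
  exact norm_smul_le c (toBanachModuleTensor w)

theorem norm_toBanachModuleTensor_add_le (w₁ w₂ : X ⊗[C] Y) :
    ‖toBanachModuleTensor (w₁ + w₂)‖ ≤
      ‖toBanachModuleTensor w₁‖ + ‖toBanachModuleTensor w₂‖ := by
  rw [map_add]
  exact norm_add_le _ _

theorem norm_toBanachModuleTensor_tmul_le (x : X) (y : Y) :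
    ‖toBanachModuleTensor (x ⊗ₜ[C] y)‖ ≤ ‖x‖ * ‖y‖ := by
  rw [toBanachModuleTensor_tmul]
  refine (Submodule.Quotient.norm_mk_le _ _).trans ?_
  rw [norm_toProjProduct]
  simpa using projNorm_le (n := 1) (x := fun _ => x) (y := fun _ => y) (by simp)

/-- The canonical map `X ⊗ Y → X ⊗_C Y`. -/
def tensorToBalanced (C X Y : Type*) [CommCStarAlgebra C]
    [NormedAddCommGroup X] [NormedSpace ℂ X] [Module C X] [IsScalarTower ℂ C X]
    [NormedAddCommGroup Y] [NormedSpace ℂ Y] [Module C Y] [IsScalarTower ℂ C Y] :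
    X ⊗[ℂ] Y →ₗ[ℂ] X ⊗[C] Y :=
  TensorProduct.mapOfCompatibleSMul C ℂ ℂ X Y

theorem tensorToBalanced_tmul (x : X) (y : Y) :
    tensorToBalanced C X Y (x ⊗ₜ[ℂ] y) = x ⊗ₜ[C] y := rfl

theorem exists_tensorToBalanced_eq (w : X ⊗[C] Y) : ∃ v, tensorToBalanced C X Y v = w := by
  induction w using TensorProduct.induction_on with
  | zero => exact ⟨0, map_zero _⟩
  | tmul x y => exact ⟨x ⊗ₜ y, rfl⟩
  | add w₁ w₂ h₁ h₂ =>
    obtain ⟨v₁, rfl⟩ := h₁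
    obtain ⟨v₂, rfl⟩ := h₂
    exact ⟨v₁ + v₂, map_add _ _ _⟩

theorem toBanachModuleTensor_tensorToBalanced (v : X ⊗[ℂ] Y) :
    toBanachModuleTensor (tensorToBalanced C X Y v) =
      (balancedSubmodule C X Y).mkQ (toProjProduct v) := by
  induction v using TensorProduct.induction_on with
  | zero =>
    rw [map_zero, map_zero, eq_comm]
    exact map_zero _
  | tmul x y => rfl
  | add w₁ w₂ h₁ h₂ => rw [map_add, map_add, h₁, h₂, toProjProduct_add, map_add]

/-- Before taking the closure, relations come from algebraic tensors that vanish in `X ⊗[C] Y`;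
adding one to a tensor therefore does not change its class. -/
theorem exists_of_mem_span_balancedRelations {z : ProjProduct X Y}
    (hz : z ∈ Submodule.span ℂ (balancedRelations C X Y)) :
    ∃ v : X ⊗[ℂ] Y, tensorToBalanced C X Y v = 0 ∧ toProjProduct v = z := by
  induction hz using Submodule.span_induction with
  | mem z hz =>
    obtain ⟨x, c, y, rfl⟩ := hz
    refine ⟨_, ?_, rfl⟩
    rw [map_sub, tensorToBalanced_tmul, tensorToBalanced_tmul, op_smul_eq_smul,
      TensorProduct.smul_tmul, sub_self]
  | zero => exact ⟨0, map_zero _, rfl⟩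
  | add z z' _ _ h h' =>
    obtain ⟨v, hv, rfl⟩ := h
    obtain ⟨v', hv', rfl⟩ := h'
    exact ⟨v + v', by rw [map_add, hv, hv', add_zero], toProjProduct_add _ _⟩
  | smul l z _ h =>
    obtain ⟨v, hv, rfl⟩ := h
    exact ⟨l • v, by rw [map_smul, hv, smul_zero], toProjProduct_smul _ _⟩

/-- The norm of `X ⊗^γ_C Y` on `X ⊗_C Y` is the infimum of `∑ ‖x_j‖ ‖y_j‖`. -/
theorem exists_rep_of_norm_toBanachModuleTensor_lt {w : X ⊗[C] Y} {t : ℝ}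
    (ht : ‖toBanachModuleTensor w‖ < t) :
    ∃ (n : ℕ) (x : Fin n → X) (y : Fin n → Y),
      w = ∑ j, x j ⊗ₜ[C] y j ∧ ∑ j, ‖x j‖ * ‖y j‖ < t := by
  obtain ⟨v, rfl⟩ := exists_tensorToBalanced_eq w
  rw [toBanachModuleTensor_tensorToBalanced] at ht
  obtain ⟨z, hz, hzt⟩ := Submodule.Quotient.norm_mk_lt
    ((balancedSubmodule C X Y).mkQ (toProjProduct v)) (sub_pos.2 ht)
  rw [add_sub_cancel] at hzt
  have hmem : z - toProjProduct v ∈ (balancedSubmodule C X Y : Set (ProjProduct X Y)) := by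
    rw [SetLike.mem_coe, ← Submodule.Quotient.eq]
    exact hz
  rw [coe_balancedSubmodule] at hmem
  -- The near-optimal lift `z` lives only in the completion. Approximating its difference from `v`
  -- by an algebraic relation `u`, within `t - ‖z‖`, gives the algebraic lift `v + u` of norm below
  -- `t`.
  obtain ⟨m, hm, hmz⟩ := Metric.mem_closure_iff.1 hmem _ (sub_pos.2 hzt)
  obtain ⟨u, hu, rfl⟩ := exists_of_mem_span_balancedRelations hm
  have hlt : projNorm (v + u) < t := by
    rw [← norm_toProjProduct, toProjProduct_add]
    rw [dist_eq_norm] at hmz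
    calc ‖toProjProduct v + toProjProduct u‖
        = ‖z - (z - toProjProduct v - toProjProduct u)‖ := by congr 1; abel
      _ ≤ ‖z‖ + ‖z - toProjProduct v - toProjProduct u‖ := norm_sub_le _ _
      _ < t := by linarith
  obtain ⟨n, x, y, hxy, hr⟩ := exists_rep_of_projNorm_lt hlt
  refine ⟨n, x, y, ?_, hr⟩
  have := congrArg (tensorToBalanced C X Y) hxy
  rw [map_add, hu, add_zero, map_sum] at this
  exact this

theorem norm_toBanachModuleTensor_sum_le {ι : Type*} (s : Finset ι) (w : ι → X ⊗[C] Y) :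
    ‖toBanachModuleTensor (∑ i ∈ s, w i)‖ ≤ ∑ i ∈ s, ‖toBanachModuleTensor (w i)‖ := by
  rw [map_sum]
  exact norm_sum_le _ _

end BanachModuleTensorNorm

/-! ### Orthogonal sums in representable bimodules and in their tensor product. -/

section OrthogonalSums

/-- Operators with orthogonal ranges and orthogonal initial spaces. -/
theorem ContinuousLinearMap.norm_add_le_max_of_orthogonal {H K : Type*}
    [NormedAddCommGroup H] [InnerProductSpace ℂ H] [CompleteSpace H]
    [NormedAddCommGroup K] [InnerProductSpace ℂ K] [CompleteSpace K] (S T : K →L[ℂ] H)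
    (h₁ : S.adjoint ∘L T = 0) (h₂ : S ∘L T.adjoint = 0) : ‖S + T‖ ≤ max ‖S‖ ‖T‖ := by
  have h₁' : T.adjoint ∘L S = 0 := by
    have := congrArg ContinuousLinearMap.adjoint h₁
    rwa [ContinuousLinearMap.adjoint_comp, ContinuousLinearMap.adjoint_adjoint, map_zero] at this
  have hsq : (S + T).adjoint ∘L (S + T) = S.adjoint ∘L S + T.adjoint ∘L T := by
    rw [map_add, ContinuousLinearMap.add_comp, ContinuousLinearMap.comp_add,
      ContinuousLinearMap.comp_add, h₁, h₁', add_zero, zero_add]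
  have hsa : ∀ U : K →L[ℂ] H, IsSelfAdjoint (U.adjoint ∘L U) := fun U => by
    rw [ContinuousLinearMap.isSelfAdjoint_iff', ContinuousLinearMap.adjoint_comp,
      ContinuousLinearMap.adjoint_adjoint]
  have hmul : (S.adjoint ∘L S) * (T.adjoint ∘L T) = 0 := by
    change (S.adjoint ∘L S) ∘L (T.adjoint ∘L T) = 0
    rw [ContinuousLinearMap.comp_assoc, ← ContinuousLinearMap.comp_assoc S, h₂,
      ContinuousLinearMap.zero_comp, ContinuousLinearMap.comp_zero]
  -- Self-adjoint operators with product zero have the maximum of their norms as the norm of their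
  -- sum; the C*-identity turns this into a statement about squares of norms.
  have hmax := (hsa S).norm_add_eq_max (hsa T) hmul
  rw [← hsq, ContinuousLinearMap.norm_adjoint_comp_self, ContinuousLinearMap.norm_adjoint_comp_self,
    ContinuousLinearMap.norm_adjoint_comp_self] at hmax
  refine abs_le_of_sq_le_sq' ?_ (le_max_of_le_left (norm_nonneg S)) |>.2
  rw [sq, hmax, sq]
  refine max_le ?_ ?_
  · exact mul_self_le_mul_self (norm_nonneg _) (le_max_left _ _)
  · exact mul_self_le_mul_self (norm_nonneg _) (le_max_right _ _)

variable {C X Y : Type*} [CommCStarAlgebra C]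
  [NormedAddCommGroup X] [NormedSpace ℂ X]
  [Module C X] [Module Cᵐᵒᵖ X] [IsCentralScalar C X] [IsScalarTower ℂ C X] [IsBoundedSMul C X]
  [NormedAddCommGroup Y] [NormedSpace ℂ Y] [Module C Y] [Module Cᵐᵒᵖ Y] [IsCentralScalar C Y]
  [IsScalarTower ℂ C Y] [IsBoundedSMul C Y]

/-- The left representation, through `π a * π b = 0`, makes the ranges orthogonal; centrality lets
the same scalars act on the right, where `σ a * σ b = 0` makes the initial spaces orthogonal. -/
theorem IsRepresentable.norm_smul_add_smul_le (hX : IsRepresentable C C X) {a b : C}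
    (ha : IsSelfAdjoint a) (hb : IsSelfAdjoint b) (hab : a * b = 0) (x x' : X) :
    ‖a • x + b • x'‖ ≤ max ‖a • x‖ ‖b • x'‖ := by
  obtain ⟨H, K, _, _, _, _, _, _, π, σ, Φ, hl, hr⟩ := hX
  have hr' : ∀ (c : C) (x : X), Φ (c • x) = (Φ x).comp (σ c) := fun c x => by
    rw [← hr, op_smul_eq_smul]
  rw [← Φ.norm_map, ← Φ.norm_map (a • x), ← Φ.norm_map (b • x'), map_add]
  refine ContinuousLinearMap.norm_add_le_max_of_orthogonal _ _ ?_ ?_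
  · rw [hl, hl, ContinuousLinearMap.adjoint_comp, ContinuousLinearMap.comp_assoc,
      ← ContinuousLinearMap.comp_assoc _ (π b)]
    have : (ContinuousLinearMap.adjoint (π a)).comp (π b) = 0 := by
      change star (π a) * π b = 0
      rw [← map_star, ha.star_eq, ← map_mul, hab, map_zero]
    rw [this, ContinuousLinearMap.zero_comp, ContinuousLinearMap.comp_zero]
  · rw [hr', hr', ContinuousLinearMap.adjoint_comp, ContinuousLinearMap.comp_assoc,
      ← ContinuousLinearMap.comp_assoc (σ a)]
    have : (σ a).comp (ContinuousLinearMap.adjoint (σ b)) = 0 := by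
      change σ a * star (σ b) = 0
      rw [← map_star, hb.star_eq, ← map_mul, hab, map_zero]
    rw [this, ContinuousLinearMap.zero_comp, ContinuousLinearMap.comp_zero]

theorem IsRepresentable.norm_smul_add_smul_le_of_le (hX : IsRepresentable C C X) {a b : C}
    (ha : IsSelfAdjoint a) (hb : IsSelfAdjoint b) (hab : a * b = 0) (ha1 : ‖a‖ ≤ 1)
    (hb1 : ‖b‖ ≤ 1) {x x' : X} {t : ℝ} (hx : ‖x‖ ≤ t) (hx' : ‖x'‖ ≤ t) :
    ‖a • x + b • x'‖ ≤ t := by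
  refine (hX.norm_smul_add_smul_le ha hb hab x x').trans (max_le ?_ ?_)
  · calc ‖a • x‖ ≤ ‖a‖ * ‖x‖ := norm_smul_le _ _
      _ ≤ 1 * ‖x‖ := by gcongr
      _ ≤ t := by linarith
  · calc ‖b • x'‖ ≤ ‖b‖ * ‖x'‖ := norm_smul_le _ _
      _ ≤ 1 * ‖x'‖ := by gcongr
      _ ≤ t := by linarith

/-- An element of norm less than one is a convex combination of elementary tensors of elements of
the unit balls. -/
theorem exists_convex_rep_of_norm_toBanachModuleTensor_lt_one {w : X ⊗[C] Y}
    (hw : ‖toBanachModuleTensor w‖ < 1) :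
    ∃ (n : ℕ) (l : Fin n → ℝ) (x : Fin n → X) (y : Fin n → Y), (∀ j, 0 ≤ l j) ∧ ∑ j, l j = 1 ∧
      (∀ j, ‖x j‖ ≤ 1) ∧ (∀ j, ‖y j‖ ≤ 1) ∧ w = ∑ j, (l j : ℂ) • (x j ⊗ₜ[C] y j) := by
  obtain ⟨n, x, y, rfl, hxy⟩ := exists_rep_of_norm_toBanachModuleTensor_lt hw
  -- The extra index carries zero vectors and absorbs the missing weight `1 - ∑ ‖x_j‖ ‖y_j‖`. The
  -- convention `0⁻¹ = 0` covers vanishing `x_j` or `y_j`.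
  refine ⟨n + 1, Fin.cons (1 - ∑ j, ‖x j‖ * ‖y j‖) (fun j => ‖x j‖ * ‖y j‖),
    Fin.cons 0 (fun j => (‖x j‖⁻¹ : ℂ) • x j), Fin.cons 0 (fun j => (‖y j‖⁻¹ : ℂ) • y j),
    ?_, ?_, ?_, ?_, ?_⟩
  · refine Fin.cases ?_ fun j => ?_
    · simpa using hxy.le
    · simp only [Fin.cons_succ]
      positivity
  · simp [Fin.sum_univ_succ]
  · refine Fin.cases (by simp) fun j => ?_
    simp only [Fin.cons_succ, norm_smul, norm_inv, Complex.norm_real, norm_norm]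
    exact inv_mul_le_one
  · refine Fin.cases (by simp) fun j => ?_
    simp only [Fin.cons_succ, norm_smul, norm_inv, Complex.norm_real, norm_norm]
    exact inv_mul_le_one
  · rw [Fin.sum_univ_succ]
    simp only [Fin.cons_zero, Fin.cons_succ, TensorProduct.zero_tmul, smul_zero, zero_add]
    refine Finset.sum_congr rfl fun j _ => ?_
    rcases eq_or_ne (x j) 0 with h | h
    · simp [h]
    rcases eq_or_ne (y j) 0 with h' | h'
    · simp [h']
    have hx : (‖x j‖ : ℂ) ≠ 0 := by exact_mod_cast (norm_pos_iff.2 h).ne'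
    have hy : (‖y j‖ : ℂ) ≠ 0 := by exact_mod_cast (norm_pos_iff.2 h').ne'
    rw [← TensorProduct.smul_tmul (R' := ℂ), smul_smul, TensorProduct.smul_tmul', smul_smul]
    push_cast
    rw [show (‖x j‖ * ‖y j‖ * ((‖y j‖ : ℂ)⁻¹ * (‖x j‖ : ℂ)⁻¹) : ℂ) = 1 by field_simp, one_smul]

theorem norm_toBanachModuleTensor_complex_smul (l : ℂ) (w : X ⊗[C] Y) :
    ‖toBanachModuleTensor (l • w)‖ = ‖l‖ * ‖toBanachModuleTensor w‖ := by
  have : toBanachModuleTensor (l • w) = l • toBanachModuleTensor w := by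
    rw [← algebraMap_smul C l w, toBanachModuleTensor_smul, algebraMap_smul]
  rw [this]
  exact norm_smul l (toBanachModuleTensor w)

/-- Orthogonal parts of elements of the open unit ball of `X ⊗^γ_C Y` add up to an element of the
unit ball. -/
theorem norm_toBanachModuleTensor_orthogonal_add_le (hX : IsRepresentable C C X)
    (hY : IsRepresentable C C Y) {a b : C} (ha : IsSelfAdjoint a) (hb : IsSelfAdjoint b)
    (hab : a * b = 0) (ha1 : ‖a‖ ≤ 1) (hb1 : ‖b‖ ≤ 1) {u v : X ⊗[C] Y}
    (hu : ‖toBanachModuleTensor u‖ < 1) (hv : ‖toBanachModuleTensor v‖ < 1) :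
    ‖toBanachModuleTensor ((a * a) • u + (b * b) • v)‖ ≤ 1 := by
  obtain ⟨n, l, x, y, hl, hl1, hx, hy, hu⟩ :=
    exists_convex_rep_of_norm_toBanachModuleTensor_lt_one hu
  obtain ⟨m, l', x', y', hl', hl1', hx', hy', hv⟩ :=
    exists_convex_rep_of_norm_toBanachModuleTensor_lt_one hv
  have hba : b * a = 0 := by rw [mul_comm, hab]
  have hmul : ∀ j k, (a • x j + b • x' k) ⊗ₜ[C] (a • y j + b • y' k) =
      (a * a) • (x j ⊗ₜ[C] y j) + (b * b) • (x' k ⊗ₜ[C] y' k) := fun j k => by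
    simp only [TensorProduct.add_tmul, TensorProduct.tmul_add, TensorProduct.tmul_smul,
      ← TensorProduct.smul_tmul', smul_add, smul_smul, hab, hba, zero_smul, add_zero, zero_add]
  -- Both families of weights have sum one, so the product weights `l j * l' k` have marginals `l`
  -- and `l'`. This couples the two representations into one convex combination.
  have key : (a * a) • u + (b * b) • v = ∑ j, ∑ k, (l j : ℂ) • (l' k : ℂ) •
      ((a • x j + b • x' k) ⊗ₜ[C] (a • y j + b • y' k)) := by
    have hc : ∑ j, (l j : ℂ) = 1 := by exact_mod_cast hl1
    have hc' : ∑ j, (l' j : ℂ) = 1 := by exact_mod_cast hl1'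
    have hcomm : ∀ (c : C) (z : ℂ) (w : X ⊗[C] Y), c • z • w = z • c • w := fun c z w =>
      smul_comm _ _ _
    simp only [hmul, smul_add, Finset.sum_add_distrib, ← Finset.smul_sum]
    simp only [← Finset.sum_smul, hc, hc', one_smul]
    rw [hu, hv]
    simp only [Finset.smul_sum, hcomm]
  rw [key]
  refine (norm_toBanachModuleTensor_sum_le _ _).trans ?_
  calc ∑ j, ‖toBanachModuleTensor (∑ k, (l j : ℂ) • (l' k : ℂ) •
          ((a • x j + b • x' k) ⊗ₜ[C] (a • y j + b • y' k)))‖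
      ≤ ∑ j, ∑ k, l j * l' k := by
        refine Finset.sum_le_sum fun j _ => (norm_toBanachModuleTensor_sum_le _ _).trans
          (Finset.sum_le_sum fun k _ => ?_)
        rw [smul_smul]
        rw [norm_toBanachModuleTensor_complex_smul, norm_mul, Complex.norm_real, Complex.norm_real,
          Real.norm_of_nonneg (hl j), Real.norm_of_nonneg (hl' k)]
        refine mul_le_of_le_one_right (mul_nonneg (hl j) (hl' k)) ?_
        refine (norm_toBanachModuleTensor_tmul_le _ _).trans (mul_le_one₀ ?_ (norm_nonneg _) ?_)
        · exact hX.norm_smul_add_smul_le_of_le ha hb hab ha1 hb1 (hx j) (hx' k)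
        · exact hY.norm_smul_add_smul_le_of_le ha hb hab ha1 hb1 (hy j) (hy' k)
    _ = 1 := by rw [← Finset.sum_mul_sum, hl1, hl1', one_mul]

end OrthogonalSums

/-! ### Cutting `f` into layers: `C`-convexity of the unit ball. -/

section Convexity

/-- The `i`-th layer of `s`, the part of `s` between `i` and `i + 1`. -/
def upperLayer (i : ℕ) (s : ℝ) : ℝ := min s (i + 1) - min s i

/-- The distance of `s` to the half-line `[i, ∞)`, truncated at `1`. -/
def lowerLayer (i : ℕ) (s : ℝ) : ℝ := max (i - s) 0 - max (i - 1 - s) 0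

theorem continuous_upperLayer (i : ℕ) : Continuous (upperLayer i) := by
  unfold upperLayer
  fun_prop

theorem continuous_lowerLayer (i : ℕ) : Continuous (lowerLayer i) := by
  unfold lowerLayer
  fun_prop

theorem upperLayer_mem_Icc (i : ℕ) (s : ℝ) : upperLayer i s ∈ Set.Icc (0 : ℝ) 1 := by
  unfold upperLayer
  constructor <;> rcases min_cases s (i + 1 : ℝ) with h | h <;>
    rcases min_cases s (i : ℝ) with h' | h' <;> linarith

theorem lowerLayer_mem_Icc (i : ℕ) (s : ℝ) : lowerLayer i s ∈ Set.Icc (0 : ℝ) 1 := by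
  unfold lowerLayer
  constructor <;> rcases max_cases (i - s : ℝ) 0 with h | h <;>
    rcases max_cases (i - 1 - s : ℝ) 0 with h' | h' <;> linarith

/-- The first function lives on `s > i`, the second on `s < i`. The layers are offset by one to
obtain this disjointness. -/
theorem upperLayer_eq_zero_or (i : ℕ) (s : ℝ) : upperLayer i s = 0 ∨ lowerLayer i s = 0 := by
  unfold upperLayer lowerLayer
  rcases le_total s i with h | h
  · left
    rw [min_eq_left h, min_eq_left (by linarith), sub_self]
  · right
    rw [max_eq_right (by linarith), max_eq_right (by linarith), sub_self]

theorem sum_upperLayer {N : ℕ} {s : ℝ} (hs : s ∈ Set.Icc (0 : ℝ) N) :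
    ∑ i ∈ Finset.range N, upperLayer i s = s := by
  have := Finset.sum_range_sub (fun i : ℕ => min s (i : ℝ)) N
  simp only [Nat.cast_add, Nat.cast_one, Nat.cast_zero, min_eq_left hs.2, min_eq_right hs.1,
    sub_zero] at this
  exact this

/-- The telescoping sum falls short of `N - s` by at most `1`: this is the price of the offset, paid
by the remainder `r` in `exists_orthogonal_layers`. -/
theorem sum_lowerLayer {N : ℕ} {s : ℝ} (hs : s ∈ Set.Icc (0 : ℝ) N) :
    ∑ i ∈ Finset.range N, lowerLayer i s = max (N - 1 - s) 0 := by
  have := Finset.sum_range_sub (fun i : ℕ => max ((i : ℝ) - 1 - s) 0) N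
  rw [Nat.cast_zero, max_eq_right (by linarith [hs.1] : (0 : ℝ) - 1 - s ≤ 0), sub_zero] at this
  rw [← this]
  refine Finset.sum_congr rfl fun i _ => ?_
  rw [lowerLayer]
  push_cast
  rw [add_sub_cancel_right]

variable {C X Y : Type*} [CommCStarAlgebra C]

theorem cfc_sqrt_mul_cfc_sqrt {f : C} {p : ℝ → ℝ} (hp : Continuous p)
    (hp0 : ∀ t, 0 ≤ p t) :
    cfc (fun t => √(p t)) f * cfc (fun t => √(p t)) f = cfc p f := by
  rw [← cfc_mul (fun t => √(p t)) (fun t => √(p t)) f]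
  exact cfc_congr fun t _ => Real.mul_self_sqrt (hp0 t)

/-- A self-adjoint element with spectrum in `[0, 1]` and its complement are, up to `1 / N`,
averages of squares of mutually orthogonal contractions. -/
theorem exists_orthogonal_layers {f : C} (hf : IsSelfAdjoint f)
    (hf1 : spectrum ℝ f ⊆ Set.Icc 0 1) (N : ℕ) :
    ∃ (a b : ℕ → C) (r : C), (∀ i, IsSelfAdjoint (a i)) ∧ (∀ i, IsSelfAdjoint (b i)) ∧
      (∀ i, a i * b i = 0) ∧ (∀ i, ‖a i‖ ≤ 1) ∧ (∀ i, ‖b i‖ ≤ 1) ∧ ‖r‖ ≤ 1 ∧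
      (N : ℂ) • f = ∑ i ∈ Finset.range N, a i * a i ∧
      (N : ℂ) • (1 - f) = ∑ i ∈ Finset.range N, b i * b i + r := by
  have hcu : ∀ i : ℕ, Continuous fun t : ℝ => upperLayer i (N * t) := fun i =>
    (continuous_upperLayer i).comp (by fun_prop)
  have hcl : ∀ i : ℕ, Continuous fun t : ℝ => lowerLayer i (N * t) := fun i =>
    (continuous_lowerLayer i).comp (by fun_prop)
  have hmem : ∀ t ∈ spectrum ℝ f, (N * t : ℝ) ∈ Set.Icc (0 : ℝ) N := fun t ht =>
    ⟨mul_nonneg N.cast_nonneg (hf1 ht).1, mul_le_of_le_one_right N.cast_nonneg (hf1 ht).2⟩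
  have hnorm : ∀ p : ℝ → ℝ, (∀ t, p t ∈ Set.Icc (0 : ℝ) 1) → ‖cfc (fun t => √(p t)) f‖ ≤ 1 :=
    fun p hp => norm_cfc_le zero_le_one fun t _ => by
      rw [Real.norm_of_nonneg (Real.sqrt_nonneg _)]
      exact Real.sqrt_le_one.2 (hp t).2
  have hN : (N : ℂ) • f = cfc (fun t : ℝ => N * t) f := by
    rw [cfc_const_mul_id (N : ℝ) f, Nat.cast_smul_eq_nsmul, Nat.cast_smul_eq_nsmul]
  -- The witnesses are square roots of the layers of `N t`, evaluated at `f`. The remainder is the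
  -- function `min 1 (N - N t)`, which has values in `[0, 1]` on the spectrum.
  refine ⟨fun i => cfc (fun t => √(upperLayer i (N * t))) f,
    fun i => cfc (fun t => √(lowerLayer i (N * t))) f,
    cfc (fun t : ℝ => N - N * t - max (N - 1 - N * t) 0) f, fun i => IsSelfAdjoint.cfc,
    fun i => IsSelfAdjoint.cfc, fun i => ?_, fun i => hnorm _ fun t => upperLayer_mem_Icc _ _,
    fun i => hnorm _ fun t => lowerLayer_mem_Icc _ _, ?_, ?_, ?_⟩
  · rw [← cfc_mul _ _ f (hcu i).sqrt.continuousOn (hcl i).sqrt.continuousOn]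
    rw [← cfc_const_zero ℝ f]
    refine cfc_congr fun t _ => ?_
    rcases upperLayer_eq_zero_or i (N * t) with h | h <;> simp [h]
  · refine norm_cfc_le zero_le_one fun t ht => ?_
    rw [Real.norm_eq_abs, abs_le]
    have := hmem t ht
    constructor <;> rcases max_cases (N - 1 - N * t : ℝ) 0 with h | h <;> linarith [this.1, this.2]
  · simp only [cfc_sqrt_mul_cfc_sqrt (hcu _) fun t => (upperLayer_mem_Icc _ _).1]
    rw [← cfc_sum _ f _ fun i _ => (hcu i).continuousOn, hN]
    refine cfc_congr fun t ht => ?_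
    rw [Finset.sum_apply, sum_upperLayer (hmem t ht)]
  · simp only [cfc_sqrt_mul_cfc_sqrt (hcl _) fun t => (lowerLayer_mem_Icc _ _).1]
    have hsum : ∑ i ∈ Finset.range N, cfc (fun t => lowerLayer i (N * t)) f =
        cfc (fun t : ℝ => max (N - 1 - N * t) 0) f := by
      rw [← cfc_sum _ f _ fun i _ => (hcl i).continuousOn]
      refine cfc_congr fun t ht => ?_
      rw [Finset.sum_apply, sum_lowerLayer (hmem t ht)]
    rw [hsum, ← cfc_add f _ _]
    have : (N : ℂ) • (1 - f) = cfc (fun t : ℝ => N - N * t) f := by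
      rw [cfc_sub (fun _ : ℝ => (N : ℝ)) _ f, ← hN, cfc_const _ f, smul_sub]
      congr 1
      simp [Nat.cast_smul_eq_nsmul]
    rw [this]
    refine cfc_congr fun t _ => ?_
    ring

variable [NormedAddCommGroup X] [NormedSpace ℂ X]
  [Module C X] [Module Cᵐᵒᵖ X] [IsCentralScalar C X] [IsScalarTower ℂ C X] [IsBoundedSMul C X]
  [NormedAddCommGroup Y] [NormedSpace ℂ Y] [Module C Y] [Module Cᵐᵒᵖ Y] [IsCentralScalar C Y]
  [IsScalarTower ℂ C Y] [IsBoundedSMul C Y]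

theorem norm_toBanachModuleTensor_convex_combination_le_of_lt (hX : IsRepresentable C C X)
    (hY : IsRepresentable C C Y) {f : C} (hf : IsSelfAdjoint f)
    (hf1 : spectrum ℝ f ⊆ Set.Icc 0 1) {u v : X ⊗[C] Y}
    (hu : ‖toBanachModuleTensor u‖ < 1) (hv : ‖toBanachModuleTensor v‖ < 1) :
    ‖toBanachModuleTensor (f • u + (1 - f) • v)‖ ≤ 1 := by
  -- Each of the `N` orthogonal layers contributes at most `1`, and so does the remainder; dividing
  -- by `N` and letting `N` grow removes the extra `1`.
  have key : ∀ N : ℕ, N * ‖toBanachModuleTensor (f • u + (1 - f) • v)‖ ≤ N + 1 := fun N => by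
    obtain ⟨a, b, r, ha, hb, hab, ha1, hb1, hr, hfN, hfN'⟩ := exists_orthogonal_layers hf hf1 N
    have hsum : (N : ℂ) • (f • u + (1 - f) • v) =
        ∑ i ∈ Finset.range N, ((a i * a i) • u + (b i * b i) • v) + r • v := by
      rw [smul_add, ← smul_assoc, ← smul_assoc, hfN, hfN', add_smul, Finset.sum_smul,
        Finset.sum_smul, Finset.sum_add_distrib, add_assoc]
    have hN : (N : ℝ) = ‖(N : ℂ)‖ := by simp
    rw [hN, ← norm_toBanachModuleTensor_complex_smul, hsum]
    refine (norm_toBanachModuleTensor_add_le _ _).trans (add_le_add ?_ ?_)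
    · refine (norm_toBanachModuleTensor_sum_le _ _).trans ((Finset.sum_le_card_nsmul _ _ 1
        fun i _ => norm_toBanachModuleTensor_orthogonal_add_le hX hY (ha i) (hb i) (hab i) (ha1 i)
          (hb1 i) hu hv).trans ?_)
      simp
    · exact (norm_toBanachModuleTensor_smul_le _ _).trans
        (mul_le_one₀ hr (norm_nonneg _) hv.le)
  by_contra! h
  obtain ⟨N, hN⟩ := exists_nat_gt (1 / (‖toBanachModuleTensor (f • u + (1 - f) • v)‖ - 1))
  rw [div_lt_iff₀ (by linarith)] at hN
  linarith [key N]

theorem norm_toBanachModuleTensor_convex_combination_le (hX : IsRepresentable C C X)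
    (hY : IsRepresentable C C Y) {f : C} (hf : IsSelfAdjoint f)
    (hf1 : spectrum ℝ f ⊆ Set.Icc 0 1) {u v : X ⊗[C] Y}
    (hu : ‖toBanachModuleTensor u‖ ≤ 1) (hv : ‖toBanachModuleTensor v‖ ≤ 1) :
    ‖toBanachModuleTensor (f • u + (1 - f) • v)‖ ≤ 1 := by
  -- Dividing by `s > 1` moves `u` and `v` into the open ball.
  refine le_of_forall_gt_imp_ge_of_dense fun s hs => ?_
  have hs0 : (0 : ℝ) < s := by linarith
  have hscale : ∀ w : X ⊗[C] Y, ‖toBanachModuleTensor ((s⁻¹ : ℂ) • w)‖ =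
      s⁻¹ * ‖toBanachModuleTensor w‖ := fun w => by
    rw [norm_toBanachModuleTensor_complex_smul, norm_inv, Complex.norm_real,
      Real.norm_of_nonneg hs0.le]
  have hlt : ∀ w : X ⊗[C] Y, ‖toBanachModuleTensor w‖ ≤ 1 →
      ‖toBanachModuleTensor ((s⁻¹ : ℂ) • w)‖ < 1 := fun w hw => by
    rw [hscale, inv_mul_lt_iff₀ hs0]
    linarith
  have := norm_toBanachModuleTensor_convex_combination_le_of_lt hX hY hf hf1 (hlt u hu) (hlt v hv)
  rw [smul_comm f, smul_comm (1 - f), ← smul_add, hscale, inv_mul_le_iff₀ hs0, mul_one] at this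
  exact this

end Convexity

/-! ### From `C`-convexity to positive and to two-sided coefficients. -/

section PositiveCoefficients

variable {C X Y : Type*} [CommCStarAlgebra C] [PartialOrder C] [StarOrderedRing C]

theorem spectrum_subset_Icc_of_nonneg_of_le_one {f : C} (h0 : 0 ≤ f) (h1 : f ≤ 1) :
    spectrum ℝ f ⊆ Set.Icc 0 1 := fun t ht => by
  refine ⟨spectrum_nonneg_of_nonneg h0 ht, ?_⟩
  refine (le_algebraMap_iff_spectrum_le (IsSelfAdjoint.of_nonneg h0)).1 ?_ t ht
  rwa [map_one]

theorem isSelfAdjoint_ringInverse {c : C} (hc : IsStrictlyPositive c) :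
    IsSelfAdjoint (Ring.inverse c) :=
  IsSelfAdjoint.of_nonneg hc.ringInverse.nonneg

theorem mul_ringInverse_mem_Icc {s c : C} (hs : 0 ≤ s) (hc : 0 ≤ c)
    (hsc : IsStrictlyPositive (s + c)) :
    0 ≤ s * Ring.inverse (s + c) ∧ s * Ring.inverse (s + c) ≤ 1 := by
  have hinv := hsc.ringInverse.nonneg
  refine ⟨(Commute.all _ _).mul_nonneg hs hinv, ?_⟩
  rw [← sub_nonneg]
  have : 1 - s * Ring.inverse (s + c) = c * Ring.inverse (s + c) := by
    rw [sub_eq_iff_eq_add, ← add_mul, add_comm c, Ring.mul_inverse_cancel _ hsc.isUnit]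
  rw [this]
  exact (Commute.all _ _).mul_nonneg hc hinv

/-- If `c ≥ (|a|² + |b|²) / 2` is invertible then `ab / c` is a contraction. -/
theorem norm_mul_mul_ringInverse_le_one {a b d : C} (hd : 0 ≤ d)
    (hc : IsStrictlyPositive ((2⁻¹ : ℝ) • (a * star a + star b * b) + d)) :
    ‖a * b * Ring.inverse ((2⁻¹ : ℝ) • (a * star a + star b * b) + d)‖ ≤ 1 := by
  set c := (2⁻¹ : ℝ) • (a * star a + star b * b) + d with hcdef
  set i := Ring.inverse c
  have hci : c * i = 1 := Ring.mul_inverse_cancel _ hc.isUnit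
  have hisa : star i = i := (isSelfAdjoint_ringInverse hc).star_eq
  have h2 : (2 : C) * ((2⁻¹ : ℝ) • (1 : C)) = 1 := by
    rw [mul_smul_comm, mul_one, ← one_add_one_eq_two (R := C), smul_add, ← add_smul]
    norm_num
  have hhalf : ∀ z : C, (2⁻¹ : ℝ) • z = ((2⁻¹ : ℝ) • (1 : C)) * z := fun z => by
    rw [smul_mul_assoc, one_mul]
  have hpos : 0 ≤ c * c - (a * star a) * (star b * b) := by
    have hp : 0 ≤ a * star a := mul_star_self_nonneg a
    have hq : 0 ≤ star b * b := star_mul_self_nonneg b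
    set p := a * star a
    set q := star b * b
    have hpq : 0 ≤ (2⁻¹ : ℝ) • (p + q) := smul_nonneg (by norm_num) (add_nonneg hp hq)
    have hdiff : 0 ≤ ((2⁻¹ : ℝ) • (p - q)) * ((2⁻¹ : ℝ) • (p - q)) := by
      have hsa : IsSelfAdjoint ((2⁻¹ : ℝ) • (p - q)) :=
        IsSelfAdjoint.smul (IsSelfAdjoint.all _)
          ((IsSelfAdjoint.of_nonneg hp).sub (IsSelfAdjoint.of_nonneg hq))
      exact hsa.mul_self_nonneg
    have h1 := (Commute.all _ _).mul_nonneg hpq hd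
    have h3 := (Commute.all _ _).mul_nonneg hd hd
    -- With `p = |a|²` and `q = |b|²`, this is `((p + q) / 2)² - pq = ((p - q) / 2)²` together with
    -- the terms containing `d`, all of them nonnegative.
    have : c * c - p * q = ((2⁻¹ : ℝ) • (p - q)) * ((2⁻¹ : ℝ) • (p - q)) +
        (((2⁻¹ : ℝ) • (p + q)) * d + ((2⁻¹ : ℝ) • (p + q)) * d + d * d) := by
      rw [hcdef, hhalf (p + q), hhalf (p - q)]
      generalize (2⁻¹ : ℝ) • (1 : C) = k at h2
      linear_combination (2 * k + 1) * (p * q) * h2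
    rw [this]
    exact add_nonneg hdiff (add_nonneg (add_nonneg h1 h1) h3)
  have hle : star (a * b * i) * (a * b * i) ≤ 1 := by
    rw [← sub_nonneg]
    have : 1 - star (a * b * i) * (a * b * i) =
        star i * (c * c - (a * star a) * (star b * b)) * i := by
      rw [star_mul, star_mul, hisa]
      linear_combination (-(c * i) - 1) * hci
    rw [this]
    exact star_left_conjugate_nonneg hpos i
  have := (CStarAlgebra.norm_le_one_iff_of_nonneg _ (star_mul_self_nonneg (a * b * i))).2 hle
  rw [CStarRing.norm_star_mul_self] at this
  nlinarith [norm_nonneg (a * b * i)]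

variable [NormedAddCommGroup X] [NormedSpace ℂ X]
  [Module C X] [Module Cᵐᵒᵖ X] [IsCentralScalar C X] [IsScalarTower ℂ C X] [IsBoundedSMul C X]
  [NormedAddCommGroup Y] [NormedSpace ℂ Y] [Module C Y] [Module Cᵐᵒᵖ Y] [IsCentralScalar C Y]
  [IsScalarTower ℂ C Y] [IsBoundedSMul C Y]

/-- Induction on `s`: if `S` is the partial sum, then `S v + c_k u_k = (S + c_k) (f v + (1 - f)
u_k)` with `f = S / (S + c_k)`, a `C`-convex combination. Strict positivity makes the division
possible. -/
theorem exists_sum_smul_eq_sum_smul (hX : IsRepresentable C C X) (hY : IsRepresentable C C Y)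
    {ι : Type*} (s : Finset ι) (c : ι → C) (hc : ∀ i, IsStrictlyPositive (c i))
    (u : ι → X ⊗[C] Y) (hu : ∀ i, ‖toBanachModuleTensor (u i)‖ ≤ 1) :
    ∃ v : X ⊗[C] Y, ‖toBanachModuleTensor v‖ ≤ 1 ∧ ∑ i ∈ s, c i • u i = (∑ i ∈ s, c i) • v := by
  classical
  induction s using Finset.induction_on with
  | empty => exact ⟨0, by simp, by simp⟩
  | insert k s hk ih =>
    obtain ⟨v, hv, hsum⟩ := ih
    rw [Finset.sum_insert hk, Finset.sum_insert hk, hsum, add_comm (c k), add_comm (c k • u k)]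
    have hS : 0 ≤ ∑ i ∈ s, c i := Finset.sum_nonneg fun i _ => (hc i).nonneg
    set S := ∑ i ∈ s, c i
    have hsc : IsStrictlyPositive (S + c k) := IsStrictlyPositive.nonneg_add hS (hc k)
    obtain ⟨h0, h1⟩ := mul_ringInverse_mem_Icc hS (hc k).nonneg hsc
    refine ⟨_, norm_toBanachModuleTensor_convex_combination_le hX hY (IsSelfAdjoint.of_nonneg h0)
      (spectrum_subset_Icc_of_nonneg_of_le_one h0 h1) hv (hu k), ?_⟩
    have hinv := Ring.mul_inverse_cancel _ hsc.isUnit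
    rw [smul_add, smul_smul, smul_smul]
    congr 2
    · linear_combination -S * hinv
    · linear_combination S * hinv

theorem norm_toBanachModuleTensor_sum_smul_le (hX : IsRepresentable C C X)
    (hY : IsRepresentable C C Y) {ι : Type*} (s : Finset ι) (c : ι → C)
    (hc : ∀ i, IsStrictlyPositive (c i)) (u : ι → X ⊗[C] Y)
    (hu : ∀ i, ‖toBanachModuleTensor (u i)‖ ≤ 1) :
    ‖toBanachModuleTensor (∑ i ∈ s, c i • u i)‖ ≤ ‖∑ i ∈ s, c i‖ := by
  obtain ⟨v, hv, hsum⟩ := exists_sum_smul_eq_sum_smul hX hY s c hc u hu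
  rw [hsum]
  exact (norm_toBanachModuleTensor_smul_le _ _).trans
    (mul_le_of_le_one_right (norm_nonneg _) hv)

theorem CommCStarAlgebra.norm_one_le (C : Type*) [CommCStarAlgebra C] : ‖(1 : C)‖ ≤ 1 := by
  cases subsingleton_or_nontrivial C
  · rw [Subsingleton.elim (1 : C) 0, norm_zero]
    exact zero_le_one
  · exact CStarRing.norm_one.le

/-- By balance and centrality the `j`-th term is `c_j ((a_j b_j / c_j) x_j ⊗ y_j)` with `c_j =
(|a_j|² + |b_j|²) / 2 + ε`. The quotient is a contraction, and `∑ c_j` has norm at most `t + n ε`,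
where `ε` serves only to make `c_j` invertible. -/
theorem norm_toBanachModuleTensor_le_gammaNorm (hX : IsRepresentable C C X)
    (hY : IsRepresentable C C Y) (w : X ⊗[C] Y) :
    ‖toBanachModuleTensor w‖ ≤ gammaNorm C C w := by
  refine le_of_forall_gt_imp_ge_of_dense fun t ht => ?_
  obtain ⟨n, a, b, x, y, h, ha, hb⟩ := exists_gammaRep_of_lt C C ht
  refine le_of_forall_pos_le_add fun δ hδ => ?_
  obtain ⟨ε, hε, hnε⟩ : ∃ ε : ℝ, 0 < ε ∧ n * ε ≤ δ :=
    ⟨δ / (n + 1), by positivity, by rw [mul_div_assoc', div_le_iff₀ (by positivity)]; nlinarith⟩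
  set d : C := algebraMap ℝ C ε with hd
  have hdpos : IsStrictlyPositive d := isStrictlyPositive_algebraMap hε
  set c : Fin n → C := fun j => (2⁻¹ : ℝ) • (a j * star (a j) + star (b j) * b j) + d with hc
  have hcpos : ∀ j, IsStrictlyPositive (c j) := fun j =>
    IsStrictlyPositive.nonneg_add (smul_nonneg (by norm_num)
      (add_nonneg (mul_star_self_nonneg _) (star_mul_self_nonneg _))) hdpos
  have hw : w = ∑ j, c j • (((a j * b j * Ring.inverse (c j)) • x j) ⊗ₜ[C] y j) := by
    rw [h.eq_sum]
    refine Finset.sum_congr rfl fun j _ => ?_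
    rw [op_smul_eq_smul, TensorProduct.tmul_smul, ← TensorProduct.smul_tmul', smul_smul,
      ← TensorProduct.smul_tmul', smul_smul]
    congr 1
    linear_combination -(a j * b j) * Ring.mul_inverse_cancel _ (hcpos j).isUnit
  rw [hw]
  refine (norm_toBanachModuleTensor_sum_smul_le hX hY _ c hcpos _ fun j => ?_).trans ?_
  · refine (norm_toBanachModuleTensor_tmul_le _ _).trans
      (mul_le_one₀ ?_ (norm_nonneg _) (h.norm_right j))
    exact (norm_smul_le _ _).trans (mul_le_one₀
      (norm_mul_mul_ringInverse_le_one hdpos.nonneg (hcpos j)) (norm_nonneg _) (h.norm_left j))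
  · have hd1 : ‖d‖ ≤ ε := by
      rw [hd, norm_algebraMap, Real.norm_of_nonneg hε.le]
      exact mul_le_of_le_one_right hε.le (CommCStarAlgebra.norm_one_le C)
    have hsum : ∑ j, c j =
        (2⁻¹ : ℝ) • (∑ j, a j * star (a j) + ∑ j, star (b j) * b j) + n • d := by
      simp [hc, Finset.sum_add_distrib, Finset.smul_sum]
    rw [hsum]
    calc _ ≤ 2⁻¹ * (‖∑ j, a j * star (a j)‖ + ‖∑ j, star (b j) * b j‖) + n * ‖d‖ := by
          refine (norm_add_le _ _).trans (add_le_add ?_ (norm_nsmul_le))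
          rw [norm_smul, Real.norm_of_nonneg (by norm_num)]
          gcongr
          exact norm_add_le _ _
      _ ≤ 2⁻¹ * (t + t) + n * ε := by gcongr
      _ ≤ t + δ := by linarith

end PositiveCoefficients

/-! ### The easy inequalities and the passage to completions. -/

section Isometries

variable {C X Y : Type*} [CommCStarAlgebra C]
  [NormedAddCommGroup X] [NormedSpace ℂ X]
  [Module C X] [Module Cᵐᵒᵖ X] [IsCentralScalar C X] [IsScalarTower ℂ C X] [IsBoundedSMul C X]
  [NormedAddCommGroup Y] [NormedSpace ℂ Y] [Module C Y] [Module Cᵐᵒᵖ Y] [IsCentralScalar C Y]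
  [IsScalarTower ℂ C Y] [IsBoundedSMul C Y] [Module ℂᵐᵒᵖ Y] [IsCentralScalar ℂ Y]

theorem exists_weighted_rep_of_norm_toBanachModuleTensor_lt {w : X ⊗[C] Y} {t : ℝ}
    (ht : ‖toBanachModuleTensor w‖ < t) :
    ∃ (n : ℕ) (l : Fin n → ℝ) (x : Fin n → X) (y : Fin n → Y), (∀ j, 0 ≤ l j) ∧ ∑ j, l j = t ∧
      (∀ j, ‖x j‖ ≤ 1) ∧ (∀ j, ‖y j‖ ≤ 1) ∧ w = ∑ j, (l j : ℂ) • (x j ⊗ₜ[C] y j) := by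
  have ht0 : 0 < t := (norm_nonneg _).trans_lt ht
  have htc : (t : ℂ) ≠ 0 := by exact_mod_cast ht0.ne'
  obtain ⟨n, l, x, y, hl, hl1, hx, hy, hw⟩ :=
    exists_convex_rep_of_norm_toBanachModuleTensor_lt_one (w := (t⁻¹ : ℂ) • w) (by
      rwa [norm_toBanachModuleTensor_complex_smul, norm_inv, Complex.norm_real,
        Real.norm_of_nonneg ht0.le, inv_mul_lt_iff₀ ht0, mul_one])
  refine ⟨n, fun j => t * l j, x, y, fun j => mul_nonneg ht0.le (hl j), ?_, hx, hy, ?_⟩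
  · rw [← Finset.mul_sum, hl1, mul_one]
  · rw [inv_smul_eq_iff₀ htc, Finset.smul_sum] at hw
    rw [hw]
    refine Finset.sum_congr rfl fun j _ => ?_
    rw [smul_smul]
    push_cast
    rfl

theorem gammaNorm_complex_le_norm_toBanachModuleTensor (w : X ⊗[C] Y) :
    gammaNorm ℂ ℂ w ≤ ‖toBanachModuleTensor w‖ := by
  refine le_of_forall_gt_imp_ge_of_dense fun t ht => ?_
  obtain ⟨n, l, x, y, hl, hlt, hx, hy, hw⟩ := exists_weighted_rep_of_norm_toBanachModuleTensor_lt ht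
  have ht0 : 0 ≤ t := (norm_nonneg _).trans ht.le
  have hsq : ∀ j, (√(l j) : ℂ) * (√(l j) : ℂ) = l j := fun j => by
    rw [← Complex.ofReal_mul, Real.mul_self_sqrt (hl j)]
  -- With `√(l j)` on both sides, each of the two sums of squares equals `∑ l j = t`.
  have hrep : GammaRep ℂ ℂ w (fun j => (√(l j) : ℂ)) (fun j => (√(l j) : ℂ)) x y := by
    refine ⟨hx, hy, ?_⟩
    rw [hw]
    refine Finset.sum_congr rfl fun j _ => ?_
    rw [op_smul_eq_smul, ← TensorProduct.smul_tmul (R' := ℂ), smul_smul, hsq,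
      TensorProduct.smul_tmul']
  have hnorm : ‖∑ j, (l j : ℂ)‖ ≤ t := by
    rw [← Complex.ofReal_sum, hlt, Complex.norm_real, Real.norm_of_nonneg ht0]
  refine hrep.gammaNorm_le ℂ ℂ ?_ ?_
  · simpa [hsq] using hnorm
  · simpa [hsq] using hnorm

theorem gammaNorm_le_gammaNorm_complex (w : X ⊗[C] Y) :
    gammaNorm C C w ≤ gammaNorm ℂ ℂ w := by
  refine le_of_forall_gt_imp_ge_of_dense fun t ht => ?_
  obtain ⟨n, a, b, x, y, h, ha, hb⟩ := exists_gammaRep_of_lt ℂ ℂ ht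
  have hrep : GammaRep C C w (fun j => algebraMap ℂ C (a j))
      (fun j => algebraMap ℂ C (b j)) x y := by
    refine ⟨h.norm_left, h.norm_right, h.eq_sum.trans (Finset.sum_congr rfl fun j _ => ?_)⟩
    rw [op_smul_eq_smul, op_smul_eq_smul, algebraMap_smul, algebraMap_smul]
  have hmap : ∀ z : ℂ, ‖algebraMap ℂ C z‖ ≤ ‖z‖ := fun z => by
    rw [norm_algebraMap]
    exact mul_le_of_le_one_right (norm_nonneg _) (CommCStarAlgebra.norm_one_le C)
  refine hrep.gammaNorm_le C C ((Eq.trans_le ?_ (hmap _)).trans ha)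
    ((Eq.trans_le ?_ (hmap _)).trans hb)
  · simp only [map_sum, map_mul, algebraMap_star_comm]
  · simp only [map_sum, map_mul, algebraMap_star_comm]

theorem gammaNorm_le_norm_sum [PartialOrder C] [StarOrderedRing C] {w : X ⊗[C] Y} {n : ℕ}
    {c : Fin n → C} {x : Fin n → X} {y : Fin n → Y} (hc : ∀ j, 0 ≤ c j) (hx : ∀ j, ‖x j‖ ≤ 1)
    (hy : ∀ j, ‖y j‖ ≤ 1) (hw : w = ∑ j, (c j • x j) ⊗ₜ[C] y j) :
    gammaNorm C C w ≤ ‖∑ j, c j‖ := by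
  have hsa : ∀ j, star (CFC.sqrt (c j)) = CFC.sqrt (c j) := fun j =>
    (IsSelfAdjoint.of_nonneg (CFC.sqrt_nonneg _)).star_eq
  have hsq : ∀ j, CFC.sqrt (c j) * CFC.sqrt (c j) = c j := fun j =>
    CFC.sqrt_mul_sqrt_self (c j) (hc j)
  have hrep : GammaRep C C w (fun j => CFC.sqrt (c j)) (fun j => CFC.sqrt (c j)) x y := by
    refine ⟨hx, hy, hw.trans (Finset.sum_congr rfl fun j _ => ?_)⟩
    rw [op_smul_eq_smul, ← TensorProduct.smul_tmul, smul_smul, hsq]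
  refine hrep.gammaNorm_le C C ?_ ?_
  · simp [hsa, hsq]
  · simp [hsa, hsq]

/-- Neither map has to be injective: equal norms give equal kernels, so the correspondence of images
is a well-defined isometry between dense subspaces. `C`-linearity extends by density and continuity.
-/
theorem exists_linearIsometryEquiv_of_norm_eq {E F G : Type*} [AddCommGroup E] [Module ℂ E]
    [SMul C E] [NormedAddCommGroup F] [NormedSpace ℂ F] [CompleteSpace F] [SMul C F]
    [ContinuousConstSMul C F] [NormedAddCommGroup G] [NormedSpace ℂ G] [CompleteSpace G] [SMul C G]
    [ContinuousConstSMul C G] (i : E →ₗ[ℂ] F) (j : E →ₗ[ℂ] G) (hi : DenseRange i)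
    (hj : DenseRange j) (hnorm : ∀ w, ‖j w‖ = ‖i w‖) (hic : ∀ (c : C) w, i (c • w) = c • i w)
    (hjc : ∀ (c : C) w, j (c • w) = c • j w) :
    ∃ e : F ≃ₗᵢ[ℂ] G, (∀ (c : C) (z : F), e (c • z) = c • e z) ∧ ∀ w, e (i w) = j w := by
  have he : ∀ w, (LinearEquiv.refl ℂ E).extendOfIsometry i j hi hj hnorm (i w) = j w := fun w =>
    LinearEquiv.extendOfIsometry_eq _ i j hi hj hnorm w
  refine ⟨(LinearEquiv.refl ℂ E).extendOfIsometry i j hi hj hnorm, fun c => ?_, he⟩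
  refine hi.induction ?_ (isClosed_eq ?_ ?_)
  · rintro _ ⟨w, rfl⟩
    rw [← hic, he, he, hjc]
  · exact (LinearIsometryEquiv.continuous _).comp (continuous_const_smul c)
  · exact (LinearIsometryEquiv.continuous _).const_smul c

/-- The canonical map `X ⊗_C Y → _A X ⊗^γ_C Y_D` as a linear map. -/
def toGammaProductLinear (A D : Type*) [CStarAlgebra A] [CStarAlgebra D] [Module A X]
    [Module Dᵐᵒᵖ Y] [IsScalarTower ℂ A X] [IsScalarTower ℂ Dᵐᵒᵖ Y] :
    X ⊗[C] Y →ₗ[ℂ] GammaProduct A C D X Y where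
  toFun w := toGammaProduct A D w
  map_add' w₁ w₂ := Completion.coe_add (α := GammaTensor A C D X Y) w₁ w₂
  map_smul' l w := Completion.coe_smul (X := GammaTensor A C D X Y) l w

/-- The canonical map `X ⊗_C Y → X ⊗^γ_C Y` as a linear map. -/
def toBanachModuleTensorLinear : X ⊗[C] Y →ₗ[ℂ] BanachModuleTensor C X Y where
  toFun := toBanachModuleTensor
  map_add' := map_add _
  map_smul' l w := by
    rw [← algebraMap_smul C l w, toBanachModuleTensor_smul, algebraMap_smul, RingHom.id_apply]

theorem denseRange_toGammaProductLinear (A D : Type*) [CStarAlgebra A] [CStarAlgebra D]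
    [Module A X] [Module Dᵐᵒᵖ Y] [IsScalarTower ℂ A X] [IsScalarTower ℂ Dᵐᵒᵖ Y] :
    DenseRange (toGammaProductLinear (C := C) (X := X) (Y := Y) A D) :=
  Completion.denseRange_coe (α := GammaTensor A C D X Y)

theorem denseRange_toBanachModuleTensorLinear :
    DenseRange (toBanachModuleTensorLinear (C := C) (X := X) (Y := Y)) := by
  have hdense : DenseRange fun v : X ⊗[ℂ] Y =>
      (balancedSubmodule C X Y).mkQ (toProjProduct v) :=
    ((balancedSubmodule C X Y).mkQ_surjective.denseRange).comp
      (Completion.denseRange_coe (α := ProjTensor X Y)) continuous_quot_mk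
  refine hdense.mono ?_
  rintro _ ⟨v, rfl⟩
  exact ⟨tensorToBalanced C X Y v, toBanachModuleTensor_tensorToBalanced v⟩

end Isometries

end

theorem mainTheorem5 {C X Y : Type*}
    -- a unital commutative C*-algebra with its usual order
    [CommCStarAlgebra C] [PartialOrder C] [StarOrderedRing C]
    -- `X` and `Y` are central Banach `C`-bimodules
    [NormedAddCommGroup X] [NormedSpace ℂ X] [CompleteSpace X]
    [Module C X] [Module Cᵐᵒᵖ X] [IsCentralScalar C X] [IsScalarTower ℂ C X] [IsBoundedSMul C X]
    [NormedAddCommGroup Y] [NormedSpace ℂ Y] [CompleteSpace Y]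
    [Module C Y] [Module Cᵐᵒᵖ Y] [IsCentralScalar C Y] [IsScalarTower ℂ C Y] [IsBoundedSMul C Y]
    -- complex scalars may be written on either side of elements of `Y`
    [Module ℂᵐᵒᵖ Y] [IsCentralScalar ℂ Y]
    (hX : IsRepresentable C C X) (hY : IsRepresentable C C Y) :
    (∀ w : X ⊗[C] Y,
      ‖toBanachModuleTensor w‖ =
        sInf {r : ℝ | ∃ (n : ℕ) (c : Fin n → C) (x : Fin n → X) (y : Fin n → Y),
          (∀ j, 0 ≤ c j) ∧ (∀ j, ‖x j‖ ≤ 1) ∧ (∀ j, ‖y j‖ ≤ 1) ∧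
          w = ∑ j, (c j • x j) ⊗ₜ[C] y j ∧ r = ‖∑ j, c j‖}) ∧
    (∀ w : X ⊗[C] Y,
      gammaNorm ℂ ℂ w = ‖toBanachModuleTensor w‖ ∧ gammaNorm C C w = ‖toBanachModuleTensor w‖) ∧
    (∃ e : GammaProduct ℂ C ℂ X Y ≃ₗᵢ[ℂ] GammaProduct C C C X Y,
      (∀ (c : C) (z : GammaProduct ℂ C ℂ X Y), e (c • z) = c • e z) ∧
      ∀ w : X ⊗[C] Y, e (toGammaProduct ℂ ℂ w) = toGammaProduct C C w) ∧
    (∃ e : GammaProduct C C C X Y ≃ₗᵢ[ℂ] BanachModuleTensor C X Y,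
      (∀ (c : C) (z : GammaProduct C C C X Y), e (c • z) = c • e z) ∧
      ∀ w : X ⊗[C] Y, e (toGammaProduct C C w) = toBanachModuleTensor w) := by
  have hle : ∀ w : X ⊗[C] Y, ‖toBanachModuleTensor w‖ ≤ gammaNorm C C w :=
    norm_toBanachModuleTensor_le_gammaNorm hX hY
  have hℂ : ∀ w : X ⊗[C] Y, gammaNorm ℂ ℂ w = ‖toBanachModuleTensor w‖ := fun w =>
    le_antisymm (gammaNorm_complex_le_norm_toBanachModuleTensor w)
      ((hle w).trans (gammaNorm_le_gammaNorm_complex w))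
  have hC : ∀ w : X ⊗[C] Y, gammaNorm C C w = ‖toBanachModuleTensor w‖ := fun w =>
    le_antisymm ((gammaNorm_le_gammaNorm_complex w).trans (hℂ w).le) (hle w)
  refine ⟨fun w => ?_, fun w => ⟨hℂ w, hC w⟩, ?_, ?_⟩
  -- Scalar weights, viewed in `C`, already come arbitrarily close to the infimum. Only `r ≤ t` is
  -- claimed since `‖(1 : C)‖ = 0` in the zero algebra.
  · have hmem : ∀ t, ‖toBanachModuleTensor w‖ < t →
        ∃ r ∈ {r : ℝ | ∃ (n : ℕ) (c : Fin n → C) (x : Fin n → X) (y : Fin n → Y),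
          (∀ j, 0 ≤ c j) ∧ (∀ j, ‖x j‖ ≤ 1) ∧ (∀ j, ‖y j‖ ≤ 1) ∧
          w = ∑ j, (c j • x j) ⊗ₜ[C] y j ∧ r = ‖∑ j, c j‖}, r ≤ t := fun t ht => by
      obtain ⟨n, l, x, y, hl, hlt, hx, hy, hw⟩ :=
        exists_weighted_rep_of_norm_toBanachModuleTensor_lt ht
      refine ⟨_, ⟨n, fun j => algebraMap ℝ C (l j), x, y,
        fun j => algebraMap_nonneg C (hl j), hx, hy, ?_, rfl⟩, ?_⟩
      · refine hw.trans (Finset.sum_congr rfl fun j _ => ?_)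
        dsimp only
        rw [TensorProduct.smul_tmul', IsScalarTower.algebraMap_apply ℝ ℂ C, algebraMap_smul]
        rfl
      · rw [← map_sum, hlt, norm_algebraMap, Real.norm_of_nonneg ((norm_nonneg _).trans ht.le)]
        exact mul_le_of_le_one_right ((norm_nonneg _).trans ht.le)
          (CommCStarAlgebra.norm_one_le C)
    refine le_antisymm (le_csInf ?_ ?_) (le_of_forall_gt_imp_ge_of_dense fun t ht => ?_)
    · obtain ⟨r, hr, -⟩ := hmem _ (lt_add_one _)
      exact ⟨r, hr⟩
    · rintro r ⟨n, c, x, y, hc, hx, hy, hw, rfl⟩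
      exact (hle w).trans (gammaNorm_le_norm_sum hc hx hy hw)
    · obtain ⟨r, hr, hrt⟩ := hmem t ht
      refine (csInf_le ⟨0, ?_⟩ hr).trans hrt
      rintro r ⟨n, c, x, y, -, -, -, -, rfl⟩
      exact norm_nonneg _
  · refine exists_linearIsometryEquiv_of_norm_eq (toGammaProductLinear ℂ ℂ)
      (toGammaProductLinear C C) (denseRange_toGammaProductLinear ℂ ℂ)
      (denseRange_toGammaProductLinear C C) (fun w => ?_)
      (fun c w => Completion.coe_smul (X := GammaTensor ℂ C ℂ X Y) c w)
      (fun c w => Completion.coe_smul (X := GammaTensor C C C X Y) c w)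
    exact (norm_toGammaProduct C C w).trans
      (((hC w).trans (hℂ w).symm).trans (norm_toGammaProduct ℂ ℂ w).symm)
  · have hsmul : ∀ (c : C) (w : X ⊗[C] Y),
        toGammaProductLinear C C (c • w) = c • toGammaProductLinear C C w := fun c w =>
      Completion.coe_smul (X := GammaTensor C C C X Y) c w
    have hsmul' : ∀ (c : C) (w : X ⊗[C] Y),
        toBanachModuleTensorLinear (c • w) = c • toBanachModuleTensorLinear w :=
      toBanachModuleTensor_smul
    have hnorm : ∀ w : X ⊗[C] Y,
        ‖toBanachModuleTensorLinear w‖ = ‖toGammaProductLinear C C w‖ := fun w =>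
      (hC w).symm.trans (norm_toGammaProduct C C w).symm
    exact exists_linearIsometryEquiv_of_norm_eq (C := C) (E := X ⊗[C] Y)
      (F := GammaProduct C C C X Y) (G := BanachModuleTensor C X Y) (toGammaProductLinear C C)
      toBanachModuleTensorLinear (denseRange_toGammaProductLinear C C)
      denseRange_toBanachModuleTensorLinear hnorm hsmul hsmul'
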